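/- Let $\mathbb{D}$ be the open unit disc of $\mathbb{C}$ and $dA=\frac{dx\,dy}{\pi}$ the normalized area measure on $\mathbb{D}$. A radial weight is a non-negative function $\omega\in L^1([0,1))$, extended to $\mathbb{D}$ by $\omega(z)=\omega(|z|)$, such that $\widehat{\omega}(r)=\int_r^1\omega(s)\,ds>0$ for all $0\le r<1$; write also $\omega_x=\int_0^1 r^x\omega(r)\,dr$ for $x\ge0$. Let $\widehat{\mathcal{D}}$ be the class of radial weights $\omega$ for which there exists $C>1$ such that $\widehat{\omega}(r)\le C\,\widehat{\omega}\left(\frac{1+r}{2}\right)$ for all $0\le r<1$, let $\mathcal{M}$ be the class of radial weights $\omega$ for which there exist $C>1$ and $K>1$ such that $\omega_x\ge C\,\omega_{Kx}$ for all $x\ge1$, and let $\mathcal{D}=\widehat{\mathcal{D}}\cap\mathcal{M}$. For a radial weight $\omega$, let $A^2_\omega$ be the Hilbert space of analytic functions $f$ on $\mathbb{D}$ with $\int_{\mathbb{D}}|f|^2\omega\,dA<\infty$, and let $B^\omega_z\in A^2_\omega$, $z\in\mathbb{D}$, be its reproducing kernels: $f(z)=\int_{\mathbb{D}}f(\zeta)\overline{B^\omega_z(\zeta)}\,\omega(\zeta)\,dA(\zeta)$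 for all $f\in A^2_\omega$. Let $2\le p<\infty$, let $N\ge1$ be an integer, let $\omega\in\widehat{\mathcal{D}}$, and let $\nu$ be a radial weight. Then for each $z\in\mathbb{D}$ the integral on the left-hand side below is finite, and there exists a constant $C=C(\omega,\nu,p,N)>0$ such that $$\int_{\mathbb{D}}\left|(1-\overline{z}\zeta)^N B^\omega_z(\zeta)\right|^p\nu(\zeta)\,dA(\zeta)\le C\left(\int_0^{|z|}\frac{\widehat{\nu}(t)}{\widehat{\omega}(t)^p(1-t)^{p(1-N)}}\,dt+1\right),\quad z\in\mathbb{D}.$$ Moreover, if $\nu\in\mathcal{D}$, then there exists a constant $c=c(\omega,\nu,p,N)>0$ such that the reverse estimate also holds: $$c\left(\int_0^{|z|}\frac{\widehat{\nu}(t)}{\widehat{\omega}(t)^p(1-t)^{p(1-N)}}\,dt+1\right)\le\int_{\mathbb{D}}\left|(1-\overline{z}\zeta)^N B^\omega_z(\zeta)\right|^p\nu(\zeta)\,dA(\zeta),\quad z\in\mathbb{D}.$$ -/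

import Mathlib

open MeasureTheory Set Metric
open scoped ComplexConjugate

noncomputable section

/-- The normalized area measure `dA = dx dy / π` on the unit disc. -/
def diskArea : Measure ℂ :=
  ENNReal.ofReal (Real.pi⁻¹) • (volume : Measure ℂ).restrict (ball 0 1)

/-- The tail integral `ω̂(r) = ∫_r^1 ω(s) ds`. -/
def weightTail (ω : ℝ → ℝ) (r : ℝ) : ℝ := ∫ s in r..1, ω s

/-- The moment `ω_x = ∫_0^1 r^x ω(r) dr`. -/
def weightMoment (ω : ℝ → ℝ) (x : ℝ) : ℝ := ∫ r in (0 : ℝ)..1, r ^ x * ω r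

/-- A radial weight: a non-negative function `ω ∈ L¹([0,1))` with `ω̂ > 0` on `[0,1)`, extended to
the unit disc by `ω(z) = ω(|z|)`. Values of `ω` outside `[0,1)` play no role. -/
structure IsRadialWeight (ω : ℝ → ℝ) : Prop where
  nonneg : ∀ r ∈ Ico (0 : ℝ) 1, 0 ≤ ω r
  integrable : IntegrableOn ω (Ico 0 1)
  tail_pos : ∀ r ∈ Ico (0 : ℝ) 1, 0 < weightTail ω r

/-- The class `𝒟̂` of radial weights with the upper doubling property. -/
def MemDHat (ω : ℝ → ℝ) : Prop :=
  IsRadialWeight ω ∧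
    ∃ C > (1 : ℝ), ∀ r ∈ Ico (0 : ℝ) 1, weightTail ω r ≤ C * weightTail ω ((1 + r) / 2)

/-- The class `ℳ` of radial weights. -/
def MemM (ω : ℝ → ℝ) : Prop :=
  IsRadialWeight ω ∧
    ∃ C > (1 : ℝ), ∃ K > (1 : ℝ), ∀ x : ℝ, 1 ≤ x →
      C * weightMoment ω (K * x) ≤ weightMoment ω x

/-- The class `𝒟 = 𝒟̂ ∩ ℳ`. -/
def MemD (ω : ℝ → ℝ) : Prop := MemDHat ω ∧ MemM ω

/-- Membership in the weighted Bergman space `A²_ω` of the unit disc (functions on `ℂ` of which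
only the restriction to the disc matters). -/
def MemBergman (ω : ℝ → ℝ) (f : ℂ → ℂ) : Prop :=
  DifferentiableOn ℂ f (ball 0 1) ∧ Integrable (fun ζ => ‖f ζ‖ ^ 2 * ω ‖ζ‖) diskArea

/-- `K` is the reproducing kernel of `A²_ω` at the point `z` of the unit disc:
`K ∈ A²_ω` and `f(z) = ⟨f, K⟩` for all `f ∈ A²_ω`. -/
def IsBergmanKernelAt (ω : ℝ → ℝ) (z : ℂ) (K : ℂ → ℂ) : Prop :=
  MemBergman ω K ∧
    ∀ f, MemBergman ω f → f z = ∫ ζ, f ζ * conj (K ζ) * (ω ‖ζ‖ : ℂ) ∂diskArea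

open Classical in
/-- The Bergman reproducing kernel `B^ω_z(ζ)`. It exists and is unique on the unit disc for
every radial weight `ω` and every `z` in the disc: see `isBergmanKernelAt_bergmanKernel` and
`IsBergmanKernelAt.eqOn` below. -/
def bergmanKernel (ω : ℝ → ℝ) (z : ℂ) : ℂ → ℂ :=
  if h : ∃ K, IsBergmanKernelAt ω z K then h.choose else 0

/-! Existence and uniqueness of the reproducing kernel. -/

theorem integrable_diskArea_iff {E : Type*} [NormedAddCommGroup E] {F : ℂ → E} :
    Integrable F diskArea ↔ IntegrableOn F (ball 0 1) := by
  unfold diskArea IntegrableOn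
  rw [integrable_smul_measure (by simp [Real.pi_pos]) (by simp)]

theorem IsRadialWeight.integrable_diskArea {ω : ℝ → ℝ} (hω : IsRadialWeight ω) :
    Integrable (fun ζ : ℂ => ω ‖ζ‖) diskArea := by
  rw [integrable_diskArea_iff, integrableOn_fun_norm_addHaar]
  have h : IntegrableOn ω (Ioo 0 1) := hω.integrable.mono_set Ioo_subset_Ico_self
  refine h.bdd_mul (c := 1) (by fun_prop) ?_
  refine (ae_restrict_iff' measurableSet_Ioo).2 (Filter.Eventually.of_forall fun y hy => ?_)
  simp [abs_of_pos hy.1, hy.2.le]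

theorem ae_diskArea {P : ℂ → Prop} (h : ∀ ζ ∈ ball (0 : ℂ) 1, P ζ) : ∀ᵐ ζ ∂diskArea, P ζ := by
  unfold diskArea
  refine Measure.ae_smul_measure ?_ _
  exact (ae_restrict_iff' measurableSet_ball).2 (Filter.Eventually.of_forall h)

theorem IsRadialWeight.nonneg_norm {ω : ℝ → ℝ} (hω : IsRadialWeight ω) {ζ : ℂ}
    (hζ : ζ ∈ ball (0 : ℂ) 1) : 0 ≤ ω ‖ζ‖ :=
  hω.nonneg _ ⟨norm_nonneg _, by simpa using hζ⟩

theorem aestronglyMeasurable_diskArea {f : ℂ → ℂ} (hf : DifferentiableOn ℂ f (ball 0 1)) :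
    AEStronglyMeasurable f diskArea := by
  unfold diskArea
  exact (hf.continuousOn.aestronglyMeasurable measurableSet_ball).smul_measure _

theorem MemBergman.integrable {ω : ℝ → ℝ} (hω : IsRadialWeight ω) {f : ℂ → ℂ}
    (hf : MemBergman ω f) : Integrable (fun ζ => f ζ * (ω ‖ζ‖ : ℂ)) diskArea := by
  refine Integrable.mono' (hf.2.add hω.integrable_diskArea) ?_ ?_
  · exact (aestronglyMeasurable_diskArea hf.1).mul
      hω.integrable_diskArea.ofReal.aestronglyMeasurable
  · refine ae_diskArea fun ζ hζ => ?_
    have h0 := hω.nonneg_norm hζ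
    simp only [norm_mul, Complex.norm_real, Real.norm_eq_abs, abs_of_nonneg h0, Pi.add_apply]
    nlinarith [sq_nonneg (‖f ζ‖ - 1), sq_nonneg (‖f ζ‖), norm_nonneg (f ζ)]

/-- The coefficients of an analytic function in the disc as averages over circles. -/
theorem circle_coefficient {f : ℂ → ℂ} (hf : DifferentiableOn ℂ f (ball 0 1)) (n : ℕ) {r : ℝ}
    (h0 : 0 < r) (h1 : r < 1) :
    ∫ θ in Ioo (-Real.pi) Real.pi, f (circleMap 0 r θ) * conj (circleMap 0 r θ) ^ n =
      2 * Real.pi * r ^ (2 * n) * ((n.factorial : ℂ)⁻¹ * iteratedDeriv n f 0) := by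
  have hr : (r : ℂ) ≠ 0 := by exact_mod_cast h0.ne'
  have hc := (hf.mono (closedBall_subset_ball h1)).circleIntegral_one_div_sub_center_pow_smul h0 n
  have hint : ∫ θ in Ioo (-Real.pi) Real.pi, f (circleMap 0 r θ) * conj (circleMap 0 r θ) ^ n =
      ∫ θ in (0 : ℝ)..2 * Real.pi, f (circleMap 0 r θ) * conj (circleMap 0 r θ) ^ n := by
    rw [← integral_Ioc_eq_integral_Ioo,
      ← intervalIntegral.integral_of_le (by linarith [Real.pi_pos])]
    have hp : Function.Periodic
        (fun θ : ℝ => f (circleMap 0 r θ) * conj (circleMap 0 r θ) ^ n) (2 * Real.pi) :=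
      fun θ => by simp only [periodic_circleMap 0 r θ]
    have := hp.intervalIntegral_add_eq (-Real.pi) 0
    rw [show -Real.pi + 2 * Real.pi = Real.pi by ring, zero_add] at this
    exact this
  rw [hint]
  have key : ∀ θ : ℝ, f (circleMap 0 r θ) * conj (circleMap 0 r θ) ^ n =
      (r ^ (2 * n) / Complex.I) * (deriv (circleMap 0 r) θ •
        ((1 / (circleMap 0 r θ - 0) ^ (n + 1)) • f (circleMap 0 r θ))) := by
    intro θ
    have hne : circleMap 0 r θ ≠ 0 := by simpa using h0.ne'
    have hm : circleMap 0 r θ * conj (circleMap 0 r θ) = (r : ℂ) ^ 2 := by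
      rw [Complex.mul_conj']; simp [abs_of_pos h0]
    have : (r : ℂ) ^ (2 * n) = (circleMap 0 r θ) ^ n * conj (circleMap 0 r θ) ^ n := by
      rw [← mul_pow, hm, pow_mul]
    rw [this, deriv_circleMap, smul_eq_mul, smul_eq_mul, sub_zero]
    field_simp
    ring
  simp_rw [key]
  rw [intervalIntegral.integral_const_mul]
  unfold circleIntegral at hc
  rw [hc, smul_eq_mul]
  field_simp

theorem integrableOn_polar {F : ℂ → ℂ} (hF : Integrable F) :
    IntegrableOn (fun p : ℝ × ℝ => p.1 • F (Complex.polarCoord.symm p)) polarCoord.target := by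
  have h1 : Integrable (F ∘ Complex.measurableEquivRealProd.symm) :=
    (Complex.volume_preserving_equiv_real_prod.symm).integrable_comp_emb
      Complex.measurableEquivRealProd.symm.measurableEmbedding |>.2 hF
  have h2 := (integrableOn_image_iff_integrableOn_abs_det_fderiv_smul volume
    polarCoord.open_target.measurableSet
    (fun p _ => (hasFDerivAt_polarCoord_symm p).hasFDerivWithinAt) polarCoord.symm.injOn
    (F ∘ Complex.measurableEquivRealProd.symm)).1 h1.integrableOn
  refine h2.congr_fun (fun p hp => ?_) polarCoord.open_target.measurableSet
  have hp1 : 0 < p.1 := hp.1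
  simp only [det_fderivPolarCoordSymm, abs_of_pos hp1, Function.comp_apply,
    Complex.measurableEquivRealProd_symm_polarCoord_symm_apply]

theorem integral_mul_conj_pow {ω : ℝ → ℝ} (hω : IsRadialWeight ω) {f : ℂ → ℂ}
    (hf : MemBergman ω f) (n : ℕ) :
    ∫ ζ, f ζ * conj ζ ^ n * (ω ‖ζ‖ : ℂ) ∂diskArea =
      2 * weightMoment ω (2 * n + 1) * ((n.factorial : ℂ)⁻¹ * iteratedDeriv n f 0) := by
  have hI : Integrable (fun ζ => f ζ * conj ζ ^ n * (ω ‖ζ‖ : ℂ)) diskArea := by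
    have : (fun ζ => f ζ * conj ζ ^ n * (ω ‖ζ‖ : ℂ)) =
        fun ζ => conj ζ ^ n * (f ζ * (ω ‖ζ‖ : ℂ)) := by ext; ring
    rw [this]
    refine (hf.integrable hω).bdd_mul (c := 1)
      (by fun_prop : Continuous fun ζ : ℂ => conj ζ ^ n).aestronglyMeasurable ?_
    refine ae_diskArea fun ζ hζ => ?_
    simpa using pow_le_one₀ (norm_nonneg _) (mem_ball_zero_iff.1 hζ).le
  rw [integrable_diskArea_iff] at hI
  set G : ℂ → ℂ := fun ζ => f ζ * conj ζ ^ n * (ω ‖ζ‖ : ℂ) with hG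
  set F : ℂ → ℂ := (ball 0 1).indicator G with hF
  have hFI : Integrable F := (integrable_indicator_iff measurableSet_ball).2 hI
  have hsym : ∀ r θ : ℝ, Complex.polarCoord.symm (r, θ) = circleMap 0 r θ := by
    intro r θ
    simp [circleMap, Complex.exp_mul_I]
  have e1 : ∫ ζ, G ζ ∂diskArea = (Real.pi : ℂ)⁻¹ * ∫ ζ, F ζ := by
    unfold diskArea
    rw [integral_smul_measure, ENNReal.toReal_ofReal (by positivity), hF,
      integral_indicator measurableSet_ball]
    simp
  rw [e1, ← Complex.integral_comp_polarCoord_symm]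
  have hpt := integrableOn_polar hFI
  rw [polarCoord_target, Measure.volume_eq_prod] at hpt ⊢
  rw [setIntegral_prod _ hpt]
  have hinner : ∀ r ∈ Ioi (0 : ℝ),
      (∫ θ in Ioo (-Real.pi) Real.pi, (r, θ).1 • F (Complex.polarCoord.symm (r, θ))) =
      (Ioo (0 : ℝ) 1).indicator (fun r : ℝ => (2 * Real.pi *
        ((n.factorial : ℂ)⁻¹ * iteratedDeriv n f 0)) * ((r ^ (2 * n + 1) * ω r : ℝ) : ℂ)) r := by
    intro r hr
    have hr : 0 < r := hr
    by_cases h1 : r < 1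
    · rw [indicator_of_mem (show r ∈ Ioo (0 : ℝ) 1 from ⟨hr, h1⟩)]
      have : ∀ θ : ℝ, (r, θ).1 • F (Complex.polarCoord.symm (r, θ)) =
          (r * ω r : ℂ) * (f (circleMap 0 r θ) * conj (circleMap 0 r θ) ^ n) := by
        intro θ
        have hm : circleMap 0 r θ ∈ ball (0 : ℂ) 1 := by simp [abs_of_pos hr, h1]
        rw [hsym, hF, indicator_of_mem hm, hG]
        simp only [norm_circleMap_zero, abs_of_pos hr, Complex.real_smul]
        ring
      simp_rw [this]
      rw [integral_const_mul, circle_coefficient hf.1 n hr h1]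
      push_cast
      ring
    · rw [indicator_of_notMem (fun h => h1 h.2)]
      have : ∀ θ : ℝ, (r, θ).1 • F (Complex.polarCoord.symm (r, θ)) = 0 := by
        intro θ
        have hm : circleMap 0 r θ ∉ ball (0 : ℂ) 1 := by
          simpa [abs_of_pos hr] using h1
        rw [hsym, hF, indicator_of_notMem hm, smul_zero]
      simp_rw [this]
      simp
  rw [setIntegral_congr_fun measurableSet_Ioi hinner, setIntegral_indicator measurableSet_Ioo,
    inter_eq_right.2 Ioo_subset_Ioi_self, integral_const_mul, integral_complex_ofReal]
  have hmom : weightMoment ω (2 * n + 1) = ∫ r in Ioo (0 : ℝ) 1, r ^ (2 * n + 1) * ω r := by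
    unfold weightMoment
    rw [intervalIntegral.integral_of_le zero_le_one, integral_Ioc_eq_integral_Ioo]
    refine setIntegral_congr_fun measurableSet_Ioo fun r _ => ?_
    rw [← Real.rpow_natCast]
    push_cast
    rfl
  rw [hmom]
  have hpi : (Real.pi : ℂ) ≠ 0 := by exact_mod_cast Real.pi_ne_zero
  field_simp

/-- Moments decay no faster than geometrically with any ratio less than one. -/
theorem IsRadialWeight.moment_lower {ω : ℝ → ℝ} (hω : IsRadialWeight ω) {ρ : ℝ} (h0 : 0 < ρ)
    (h1 : ρ < 1) (n : ℕ) :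
    ρ ^ (2 * n + 1) * weightTail ω ρ ≤ weightMoment ω (2 * n + 1) := by
  have hint : IntegrableOn ω (Ioc 0 1) := by
    rw [integrableOn_Ioc_iff_integrableOn_Ioo]
    exact hω.integrable.mono_set Ioo_subset_Ico_self
  have hpow : ∀ r : ℝ, r ^ (2 * (n : ℝ) + 1) = r ^ (2 * n + 1) := fun r => by
    rw [← Real.rpow_natCast]; push_cast; rfl
  unfold weightMoment weightTail
  rw [intervalIntegral.integral_of_le zero_le_one, intervalIntegral.integral_of_le h1.le,
    integral_Ioc_eq_integral_Ioo, integral_Ioc_eq_integral_Ioo, ← integral_const_mul]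
  simp_rw [hpow]
  have hI : IntegrableOn (fun r => r ^ (2 * n + 1) * ω r) (Ioo 0 1) := by
    refine (hint.mono_set Ioo_subset_Ioc_self).bdd_mul (c := 1) (by fun_prop) ?_
    refine (ae_restrict_iff' measurableSet_Ioo).2 (Filter.Eventually.of_forall fun y hy => ?_)
    simpa [abs_of_pos hy.1] using pow_le_one₀ hy.1.le hy.2.le
  have hsub : Ioo ρ 1 ⊆ Ioo (0 : ℝ) 1 := Ioo_subset_Ioo_left h0.le
  calc ∫ r in Ioo ρ 1, ρ ^ (2 * n + 1) * ω r
      ≤ ∫ r in Ioo ρ 1, r ^ (2 * n + 1) * ω r := by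
        refine setIntegral_mono_on ?_ (hI.mono_set hsub) measurableSet_Ioo fun r hr => ?_
        · exact (hint.mono_set (hsub.trans Ioo_subset_Ioc_self)).const_mul _
        · exact mul_le_mul_of_nonneg_right (pow_le_pow_left₀ h0.le hr.1.le _)
            (hω.nonneg r ⟨h0.le.trans hr.1.le, hr.2⟩)
    _ ≤ ∫ r in Ioo 0 1, r ^ (2 * n + 1) * ω r := by
        refine setIntegral_mono_set hI ?_ hsub.eventuallyLE
        exact (ae_restrict_iff' measurableSet_Ioo).2 (Filter.Eventually.of_forall fun r hr =>
          mul_nonneg (pow_nonneg hr.1.le _) (hω.nonneg r ⟨hr.1.le, hr.2⟩))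

theorem IsRadialWeight.moment_pos {ω : ℝ → ℝ} (hω : IsRadialWeight ω) (n : ℕ) :
    0 < weightMoment ω (2 * n + 1) :=
  lt_of_lt_of_le (mul_pos (by positivity) (hω.tail_pos (1 / 2) ⟨by norm_num, by norm_num⟩))
    (hω.moment_lower (by norm_num) (by norm_num) n)

theorem IsRadialWeight.summable_kernel {ω : ℝ → ℝ} (hω : IsRadialWeight ω) {z : ℂ}
    (hz : z ∈ ball (0 : ℂ) 1) :
    Summable fun n : ℕ => ‖z‖ ^ n / (2 * weightMoment ω (2 * n + 1)) := by
  have hz1 : ‖z‖ < 1 := by simpa using hz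
  obtain ⟨s, hs1, hs2⟩ := exists_between hz1
  have hs0 : 0 < s := (norm_nonneg z).trans_lt hs1
  set ρ := Real.sqrt s with hρ
  have hρ0 : 0 < ρ := Real.sqrt_pos.2 hs0
  have hρ2 : ρ ^ 2 = s := Real.sq_sqrt hs0.le
  have hρ1 : ρ < 1 := by nlinarith
  have ht := hω.tail_pos ρ ⟨hρ0.le, hρ1⟩
  have hg : Summable fun n : ℕ => (2 * ρ * weightTail ω ρ)⁻¹ * (‖z‖ / s) ^ n :=
    (summable_geometric_of_lt_one (by positivity) ((div_lt_one hs0).2 hs1)).mul_left _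
  refine Summable.of_nonneg_of_le (fun n => ?_) (fun n => ?_) hg
  · have := hω.moment_pos n
    positivity
  · have hm := hω.moment_lower hρ0 hρ1 n
    have hm' : s ^ n * ρ * weightTail ω ρ ≤ weightMoment ω (2 * n + 1) := by
      rw [← hρ2, ← pow_mul, ← pow_succ]; exact hm
    have hp : 0 < s ^ n * ρ * weightTail ω ρ := by positivity
    calc ‖z‖ ^ n / (2 * weightMoment ω (2 * n + 1))
        ≤ ‖z‖ ^ n / (2 * (s ^ n * ρ * weightTail ω ρ)) := by gcongr
      _ = (2 * ρ * weightTail ω ρ)⁻¹ * (‖z‖ / s) ^ n := by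
        rw [div_pow]; field_simp

theorem isBergmanKernelAt_tsum {ω : ℝ → ℝ} (hω : IsRadialWeight ω) {z : ℂ}
    (hz : z ∈ ball (0 : ℂ) 1) :
    IsBergmanKernelAt ω z
      (fun ζ => ∑' n : ℕ, (conj z * ζ) ^ n / (2 * weightMoment ω (2 * n + 1) : ℝ)) := by
  set a : ℕ → ℝ := fun n => ‖z‖ ^ n / (2 * weightMoment ω (2 * n + 1)) with ha
  have hsum : Summable a := hω.summable_kernel hz
  have hbd : ∀ n : ℕ, ∀ ζ ∈ ball (0 : ℂ) 1,
      ‖(conj z * ζ) ^ n / (2 * weightMoment ω (2 * n + 1) : ℝ)‖ ≤ a n := by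
    intro n ζ hζ
    have := hω.moment_pos n
    have hζ1 : ‖ζ‖ ≤ 1 := (mem_ball_zero_iff.1 hζ).le
    rw [norm_div, norm_pow, norm_mul, Complex.norm_conj, Complex.norm_real, Real.norm_eq_abs,
      abs_of_pos (by positivity)]
    refine div_le_div_of_nonneg_right (pow_le_pow_left₀ (by positivity) ?_ n) (by positivity)
    exact mul_le_of_le_one_right (norm_nonneg _) hζ1
  set K : ℂ → ℂ :=
    fun ζ => ∑' n : ℕ, (conj z * ζ) ^ n / (2 * weightMoment ω (2 * n + 1) : ℝ) with hK
  have hKd : DifferentiableOn ℂ K (ball 0 1) := by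
    refine Complex.differentiableOn_tsum_of_summable_norm hsum (fun n => ?_) isOpen_ball hbd
    fun_prop
  have hKb : ∀ ζ ∈ ball (0 : ℂ) 1, ‖K ζ‖ ≤ ∑' n, a n := fun ζ hζ =>
    tsum_of_norm_bounded hsum.hasSum fun n => hbd n ζ hζ
  refine ⟨⟨hKd, ?_⟩, ?_⟩
  · refine hω.integrable_diskArea.bdd_mul (c := (∑' n, a n) ^ 2)
      ((aestronglyMeasurable_diskArea hKd).norm.pow 2) ?_
    refine ae_diskArea fun ζ hζ => ?_
    rw [norm_pow, norm_norm]
    exact pow_le_pow_left₀ (norm_nonneg _) (hKb ζ hζ) 2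
  · intro f hf
    set T : ℕ → ℂ → ℂ := fun n ζ =>
      (z ^ n / (2 * weightMoment ω (2 * n + 1) : ℝ)) * (f ζ * conj ζ ^ n * (ω ‖ζ‖ : ℂ)) with hT
    have hTn : ∀ n, ∀ ζ ∈ ball (0 : ℂ) 1, ‖T n ζ‖ ≤ a n * ‖f ζ * (ω ‖ζ‖ : ℂ)‖ := by
      intro n ζ hζ
      have := hω.moment_pos n
      have hζ1 : ‖ζ‖ ≤ 1 := (mem_ball_zero_iff.1 hζ).le
      have h1 : ‖ζ‖ ^ n ≤ 1 := pow_le_one₀ (norm_nonneg _) hζ1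
      simp only [hT, norm_mul, norm_div, norm_pow, Complex.norm_conj, Complex.norm_real]
      rw [Real.norm_eq_abs, Real.norm_eq_abs, abs_of_pos (by positivity : (0 : ℝ) < 2),
        abs_of_pos this]
      have : ‖f ζ‖ * ‖ζ‖ ^ n * |ω ‖ζ‖| ≤ ‖f ζ‖ * |ω ‖ζ‖| := by
        have h2 : 0 ≤ ‖f ζ‖ * |ω ‖ζ‖| := by positivity
        nlinarith
      exact mul_le_mul_of_nonneg_left this (by positivity)
    have hTI : ∀ n, Integrable (T n) diskArea := by
      intro n
      refine Integrable.mono' ((hf.integrable hω).norm.const_mul (a n)) ?_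
        (ae_diskArea (hTn n))
      exact (((aestronglyMeasurable_diskArea hf.1).mul
        (by fun_prop : Continuous fun ζ : ℂ => conj ζ ^ n).aestronglyMeasurable).mul
        hω.integrable_diskArea.ofReal.aestronglyMeasurable).const_mul _
    have hTS : Summable fun n => ∫ ζ, ‖T n ζ‖ ∂diskArea := by
      refine Summable.of_nonneg_of_le (fun n => integral_nonneg fun _ => norm_nonneg _)
        (fun n => ?_) (hsum.mul_right (∫ ζ, ‖f ζ * (ω ‖ζ‖ : ℂ)‖ ∂diskArea))
      rw [← integral_const_mul]
      exact integral_mono_ae (hTI n).norm ((hf.integrable hω).norm.const_mul _)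
        (ae_diskArea (hTn n))
    have hS := hasSum_integral_of_summable_integral_norm hTI hTS
    have hval : ∀ n, ∫ ζ, T n ζ ∂diskArea =
        (n.factorial : ℂ)⁻¹ • (z - 0) ^ n • iteratedDeriv n f 0 := by
      intro n
      have hne : (weightMoment ω (2 * n + 1) : ℂ) ≠ 0 := by exact_mod_cast (hω.moment_pos n).ne'
      simp only [hT]
      rw [integral_const_mul, integral_mul_conj_pow hω hf n]
      simp only [smul_eq_mul, sub_zero]
      push_cast
      field_simp
    simp_rw [hval] at hS
    rw [(Complex.hasSum_taylorSeries_on_ball hf.1 hz).unique hS]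
    refine integral_congr_ae (ae_diskArea fun ζ hζ => ?_)
    simp only [hT, hK]
    rw [Complex.conj_tsum, ← tsum_mul_left, ← tsum_mul_right]
    refine tsum_congr fun n => ?_
    simp only [map_div₀, map_pow, map_mul, Complex.conj_conj, Complex.conj_ofReal]
    ring

theorem memBergman_pow {ω : ℝ → ℝ} (hω : IsRadialWeight ω) (n : ℕ) :
    MemBergman ω (fun ζ => ζ ^ n) := by
  refine ⟨by fun_prop, hω.integrable_diskArea.bdd_mul (c := 1)
    (by fun_prop : Continuous fun ζ : ℂ => ‖ζ ^ n‖ ^ 2).aestronglyMeasurable ?_⟩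
  refine ae_diskArea fun ζ hζ => ?_
  have : ‖ζ‖ ^ n ≤ 1 := pow_le_one₀ (norm_nonneg _) (mem_ball_zero_iff.1 hζ).le
  simpa using pow_le_one₀ (n := 2) (by positivity) this

/-- The reproducing kernel is unique on the disc. -/
theorem IsBergmanKernelAt.eqOn {ω : ℝ → ℝ} (hω : IsRadialWeight ω) {z : ℂ} {K L : ℂ → ℂ}
    (hK : IsBergmanKernelAt ω z K) (hL : IsBergmanKernelAt ω z L) : EqOn K L (ball 0 1) := by
  have hcoef : ∀ n : ℕ, iteratedDeriv n K 0 = iteratedDeriv n L 0 := by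
    intro n
    have key : ∀ M : ℂ → ℂ, IsBergmanKernelAt ω z M →
        2 * weightMoment ω (2 * n + 1) * ((n.factorial : ℂ)⁻¹ * iteratedDeriv n M 0) =
          conj (z ^ n) := by
      intro M hM
      rw [← integral_mul_conj_pow hω hM.1 n, hM.2 _ (memBergman_pow hω n), ← integral_conj]
      refine integral_congr_ae (Filter.Eventually.of_forall fun ζ => ?_)
      simp only [map_mul, map_pow, Complex.conj_conj, Complex.conj_ofReal]
      ring
    have h := (key K hK).trans (key L hL).symm
    have hne : (weightMoment ω (2 * n + 1) : ℂ) ≠ 0 := by exact_mod_cast (hω.moment_pos n).ne'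
    have hfac : (n.factorial : ℂ) ≠ 0 := by exact_mod_cast n.factorial_ne_zero
    exact mul_left_cancel₀ (inv_ne_zero hfac) (mul_left_cancel₀ (mul_ne_zero two_ne_zero hne) h)
  intro ζ hζ
  have h1 := Complex.hasSum_taylorSeries_on_ball hK.1.1 hζ
  have h2 := Complex.hasSum_taylorSeries_on_ball hL.1.1 hζ
  simp_rw [hcoef] at h1
  exact h1.unique h2

/-- `bergmanKernel ω z` is the reproducing kernel of `A²_ω` at `z`. -/
theorem isBergmanKernelAt_bergmanKernel {ω : ℝ → ℝ} (hω : IsRadialWeight ω) {z : ℂ}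
    (hz : z ∈ ball (0 : ℂ) 1) : IsBergmanKernelAt ω z (bergmanKernel ω z) := by
  have h : ∃ K, IsBergmanKernelAt ω z K := ⟨_, isBergmanKernelAt_tsum hω hz⟩
  unfold bergmanKernel
  rw [dif_pos h]
  exact h.choose_spec

end

/-! The weight enters only through the measure `ω(r) dr` on `(0,1)`; write `μ` for it and `τ(t) =
μ(t,1)` for its tail. The kernel is `K(w) = ∑ b_n w^n` at `w = conj z * ζ`, where `b_n` is the
reciprocal of twice the moment of order `2n+1`. Everything reduces to the size of `K` on circles,
followed by two applications of Tonelli's theorem.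

Size of `K`. Doubling makes the moment of order `n` comparable to `τ(1 - 1/(n+1))`, so `b_n` is
comparable to `1 / τ(1 - 1/(n+1))` and grows at most polynomially. A `j`-fold forward difference of
the moments inserts a factor `(r^2 - 1)^j` under the integral and gains `(n+1)^(-j)`; Leibniz-type
rules carry this gain over to the reciprocals `b_n` (`fwdDiff_kernelCoeff_bound`). Cutting the
series at `m` of order `1/|1-w|` and summing the rest by parts sufficiently often gives `|K(w)| ≲ 1
/ (v τ(1-v))` for `v` of order `|1-w|` (`norm_kernelSeries_le_tail`). Near the positive radius the
bound is sharp, because the coefficients are positive and `K` varies little over an arc of length a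
small multiple of `1-ρ` (`le_norm_kernelSeries`).

Upper estimate. Put `H(t) = ((1-t)^(N-1) / τ(t))^p`, the density in the theorem. On the circle of
radius `ρ`, `|1-w|` is of order `1-ρ+|θ|`, so `|(1-w)^N K(w)|^p` is bounded by a multiple of
`H(ρ-|θ|)`, or by a constant when `|θ| ≥ ρ`. The circle mean is thus `≲ 1 + ∫_0^ρ H`, and
integration in `r` with `ρ = |z|r` turns this into `1 + ∫_0^|z| H ν̂`, with no regularity of `ν`.

Lower estimate. The arc `|θ| ≤ ε(1-ρ)` alone gives a circle mean `≳ (1-ρ)H(ρ)`. If `ν ∈ 𝒟`, the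
decay of the moments forces a fixed proportion of `ν(t,1)` to sit at distance comparable to `1-t`
from `1` (`tail_le_lintegral_shell`). Replacing the tail by this shell and exchanging integrals, for
fixed `r` the relevant `t ≤ |z|` fill a set of length `≲ 1-r` on which `H(t) ≲ H(|z|r)`, and the
lower bound for the means takes over (`le_lintegral_kernelMean`). -/

/-! ### Finite measures on the unit interval with doubling tails -/

/-- A finite measure on `(0,1)` whose tail `t ↦ μ (t, 1)` is positive and doubling at `1`. -/
structure IsTailDoubling (μ : Measure ℝ) : Prop where
  isFinite : IsFiniteMeasure μ
  ae_mem : ∀ᵐ r ∂μ, r ∈ Ioo (0 : ℝ) 1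
  tail_pos : ∀ t ∈ Ico (0 : ℝ) 1, 0 < μ.real (Ioi t)
  doubling : ∃ C : ℝ, ∀ t ∈ Ico (0 : ℝ) 1, μ.real (Ioi t) ≤ C * μ.real (Ioi ((1 + t) / 2))

theorem tail_antitone (μ : Measure ℝ) [IsFiniteMeasure μ] : Antitone fun t => μ.real (Ioi t) :=
  fun _ _ h => measureReal_mono (Ioi_subset_Ioi h)

theorem one_sub_inv_mem_Ico (n : ℕ) : 1 - 1 / ((n : ℝ) + 1) ∈ Ico (0 : ℝ) 1 := by
  have h : (0 : ℝ) < (n : ℝ) + 1 := by positivity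
  have h1 : 1 / ((n : ℝ) + 1) ≤ 1 := by
    rw [div_le_one h]; linarith [(Nat.cast_nonneg n : (0 : ℝ) ≤ n)]
  have h2 : 0 < 1 / ((n : ℝ) + 1) := by positivity
  exact ⟨by linarith, by linarith⟩

/-- Here `n + 1` is the integer part of `1 / (1 - t)`. This is the passage from the continuous
variable `t` to an index of the power series. -/
theorem exists_one_sub_inv_near {t : ℝ} (ht : t ∈ Ico (0 : ℝ) 1) :
    ∃ n : ℕ, ((n : ℝ) + 1) * (1 - t) ≤ 1 ∧ 1 < ((n : ℝ) + 2) * (1 - t) := by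
  have h1 : 0 < 1 - t := by linarith [ht.2]
  have h2 : 1 ≤ 1 / (1 - t) := by rw [le_div_iff₀ h1]; linarith [ht.1]
  have h3 : 1 ≤ ⌊1 / (1 - t)⌋₊ := Nat.le_floor (by exact_mod_cast h2)
  refine ⟨⌊1 / (1 - t)⌋₊ - 1, ?_, ?_⟩
  · have := Nat.floor_le (show 0 ≤ 1 / (1 - t) by positivity)
    rw [le_div_iff₀ h1] at this
    push_cast [Nat.cast_sub h3]
    linarith
  · have := Nat.lt_floor_add_one (1 / (1 - t))
    rw [div_lt_iff₀ h1] at this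
    push_cast [Nat.cast_sub h3]
    linarith

theorem pow_le_exp {r : ℝ} (h0 : 0 ≤ r) (n : ℕ) : r ^ n ≤ Real.exp (-(n * (1 - r))) := by
  have h : r ≤ Real.exp (r - 1) := by linarith [Real.add_one_le_exp (r - 1)]
  calc r ^ n ≤ Real.exp (r - 1) ^ n := pow_le_pow_left₀ h0 h n
    _ = Real.exp (-(n * (1 - r))) := by rw [← Real.exp_nat_mul]; congr 1; ring

/-- With `x = (n+1)(1-r)`, `x^j / j! ≤ e^x` is played against `r^n ≤ e^(-n(1-r))`, leaving only
`e^(1-r)`. It says that a factor `(1-r)^j` in a moment of order `n` is worth `(n+1)^(-j)`. -/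
theorem pow_mul_pow_le_factorial {r : ℝ} (h0 : 0 ≤ r) (h1 : r ≤ 1) (n j : ℕ) :
    (((n : ℝ) + 1) * (1 - r)) ^ j * r ^ n ≤ j.factorial * Real.exp 1 := by
  have hx : 0 ≤ ((n : ℝ) + 1) * (1 - r) := mul_nonneg (by positivity) (by linarith)
  have h2 := Real.pow_div_factorial_le_exp _ hx j
  rw [div_le_iff₀ (by positivity)] at h2
  calc (((n : ℝ) + 1) * (1 - r)) ^ j * r ^ n
      ≤ (Real.exp (((n : ℝ) + 1) * (1 - r)) * j.factorial) * Real.exp (-(n * (1 - r))) :=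
        mul_le_mul h2 (pow_le_exp h0 n) (by positivity) (by positivity)
    _ = j.factorial * Real.exp (1 - r) := by
        rw [mul_comm (Real.exp _), mul_assoc, ← Real.exp_add]; congr 2; ring
    _ ≤ j.factorial * Real.exp 1 := by gcongr; linarith

/-- `(1 - 1/(n+1))^n` is at least `1/e`. -/
theorem exp_neg_one_le_pow (n : ℕ) : Real.exp (-1) ≤ (1 - 1 / ((n : ℝ) + 1)) ^ n := by
  rcases Nat.eq_zero_or_pos n with rfl | hn
  · simp
  have hn' : (0 : ℝ) < n := by exact_mod_cast hn
  have h1 : 1 - 1 / ((n : ℝ) + 1) = (1 + 1 / (n : ℝ))⁻¹ := by field_simp; ring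
  have h2 : (1 + 1 / (n : ℝ)) ^ n ≤ Real.exp 1 := by
    calc (1 + 1 / (n : ℝ)) ^ n ≤ Real.exp (1 / (n : ℝ)) ^ n := by
          gcongr; linarith [Real.add_one_le_exp (1 / (n : ℝ))]
      _ = Real.exp 1 := by rw [← Real.exp_nat_mul]; congr 1; field_simp
  rw [h1, inv_pow, Real.exp_neg]
  gcongr

namespace IsTailDoubling

variable {μ : Measure ℝ}

theorem integrable_of_continuous (h : IsTailDoubling μ) {f : ℝ → ℝ} (hf : Continuous f) :
    Integrable f μ := by
  have := h.isFinite
  obtain ⟨C, hC⟩ := isCompact_Icc.exists_bound_of_continuousOn (hf.continuousOn (s := Icc 0 1))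
  exact Integrable.of_bound hf.aestronglyMeasurable C
    (h.ae_mem.mono fun r hr => hC r ⟨hr.1.le, hr.2.le⟩)

/-- The tail grows at most polynomially away from `1`. -/
theorem tail_le (h : IsTailDoubling μ) : ∃ C > (0 : ℝ), ∃ β : ℕ, ∀ s ∈ Ico (0 : ℝ) 1,
    ∀ t ∈ Ico (0 : ℝ) 1,
      μ.real (Ioi s) ≤ C * (1 + (1 - s) / (1 - t)) ^ β * μ.real (Ioi t) := by
  have := h.isFinite
  obtain ⟨C₀, hC₀⟩ := h.doubling
  set C := max C₀ 1 with hCdef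
  have hC1 : 1 ≤ C := le_max_right _ _
  have hC : ∀ t ∈ Ico (0 : ℝ) 1, μ.real (Ioi t) ≤ C * μ.real (Ioi ((1 + t) / 2)) :=
    fun t ht => (hC₀ t ht).trans (by gcongr; exact le_max_left _ _)
  have hiter : ∀ j : ℕ, ∀ s ∈ Ico (0 : ℝ) 1,
      μ.real (Ioi s) ≤ C ^ j * μ.real (Ioi (1 - (1 - s) / 2 ^ j)) := by
    intro j
    induction j with
    | zero => intro s _; simp
    | succ j ih =>
      intro s hs
      have h1 := ih ((1 + s) / 2) ⟨by linarith [hs.1], by linarith [hs.2]⟩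
      calc μ.real (Ioi s) ≤ C * μ.real (Ioi ((1 + s) / 2)) := hC s hs
        _ ≤ C * (C ^ j * μ.real (Ioi (1 - (1 - (1 + s) / 2) / 2 ^ j))) := by gcongr
        _ = C ^ (j + 1) * μ.real (Ioi (1 - (1 - s) / 2 ^ (j + 1))) := by
          rw [pow_succ' C, mul_assoc]
          congr 5
          rw [pow_succ']; field_simp; ring
  -- With `C < 2^β`, the `n+1` doublings needed to go from `s` past `t` cost `C^(n+1) ≤
  -- (2^(n+1))^β`, and `2^(n+1) ≤ 2x` for `x = (1-s)/(1-t)`. The summand `1` in the bound covers the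
  -- case `t ≤ s`.
  obtain ⟨β, hβ⟩ := pow_unbounded_of_one_lt C one_lt_two
  refine ⟨2 ^ β, by positivity, β, fun s hs t ht => ?_⟩
  have hs1 : 0 < 1 - s := by linarith [hs.2]
  have ht1 : 0 < 1 - t := by linarith [ht.2]
  rcases le_total t s with hst | hst
  · have h1 : (1 : ℝ) ≤ 2 ^ β * (1 + (1 - s) / (1 - t)) ^ β :=
      one_le_mul_of_one_le_of_one_le (one_le_pow₀ one_le_two)
        (one_le_pow₀ (by linarith [div_pos hs1 ht1]))
    calc μ.real (Ioi s) ≤ 1 * μ.real (Ioi t) := by rw [one_mul]; exact tail_antitone μ hst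
      _ ≤ _ := by gcongr
  · set x := (1 - s) / (1 - t) with hx
    have hx1 : 1 ≤ x := by rw [hx, le_div_iff₀ ht1]; linarith
    obtain ⟨n, hn1, hn2⟩ := exists_nat_pow_near hx1 (one_lt_two)
    have h1 := hiter (n + 1) s hs
    have h2 : t ≤ 1 - (1 - s) / 2 ^ (n + 1) := by
      have : (1 - s) / 2 ^ (n + 1) ≤ 1 - t := by
        rw [div_le_iff₀ (by positivity)]
        rw [hx, div_lt_iff₀ ht1] at hn2
        linarith
      linarith
    calc μ.real (Ioi s) ≤ C ^ (n + 1) * μ.real (Ioi (1 - (1 - s) / 2 ^ (n + 1))) := h1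
      _ ≤ C ^ (n + 1) * μ.real (Ioi t) :=
          mul_le_mul_of_nonneg_left (tail_antitone μ h2) (by positivity)
      _ ≤ (2 ^ β) ^ (n + 1) * μ.real (Ioi t) := by gcongr
      _ = (2 ^ (n + 1)) ^ β * μ.real (Ioi t) := by rw [← pow_mul, ← pow_mul, mul_comm β]
      _ ≤ (2 * (1 + x)) ^ β * μ.real (Ioi t) := by
          gcongr
          rw [pow_succ']
          linarith
      _ = 2 ^ β * (1 + x) ^ β * μ.real (Ioi t) := by rw [mul_pow]

/-- Layer-cake formula for `r^(k+1) = ∫_0^r (k+1) t^k dt`; levels `t ≥ 1` contribute nothing since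
`μ` lives on `(0,1)`. -/
theorem lintegral_pow_eq (h : IsTailDoubling μ) (k : ℕ) :
    ENNReal.ofReal (∫ r, r ^ (k + 1) ∂μ) =
      ∫⁻ t in Ioo (0 : ℝ) 1, μ (Ioi t) * ENNReal.ofReal ((k + 1) * t ^ k) := by
  have := h.isFinite
  have hnn : 0 ≤ᵐ[μ] fun r : ℝ => r := h.ae_mem.mono fun r hr => hr.1.le
  rw [ofReal_integral_eq_lintegral_ofReal (h.integrable_of_continuous (by fun_prop))
    (hnn.mono fun r hr => pow_nonneg hr _)]
  have h1 := lintegral_comp_eq_lintegral_meas_lt_mul μ hnn aemeasurable_id'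
    (g := fun t : ℝ => ((k : ℝ) + 1) * t ^ k)
    (fun t _ => (by fun_prop : Continuous fun t : ℝ => ((k : ℝ) + 1) * t ^ k).intervalIntegrable _ _)
    ((ae_restrict_iff' measurableSet_Ioi).2 (Filter.Eventually.of_forall fun t ht => by
      have : (0 : ℝ) < t := ht
      positivity))
  have h2 : ∀ r : ℝ, ∫ t in (0 : ℝ)..r, ((k : ℝ) + 1) * t ^ k = r ^ (k + 1) := by
    intro r
    rw [intervalIntegral.integral_const_mul, integral_pow]
    field_simp
    simp
  simp_rw [h2] at h1
  rw [h1, ← Ioo_union_Ici_eq_Ioi (zero_lt_one' ℝ),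
    lintegral_union measurableSet_Ici (by
      rw [Set.disjoint_left]; intro x hx hx'; exact absurd hx.2 (not_lt.2 hx'))]
  have h3 : ∫⁻ t in Ici (1 : ℝ), μ {a : ℝ | t < a} * ENNReal.ofReal ((k + 1) * t ^ k) = 0 := by
    rw [setLIntegral_congr_fun (g := fun _ => 0) measurableSet_Ici (fun t ht => ?_)]
    · simp
    have : μ {a : ℝ | t < a} = 0 := by
      refine measure_eq_zero_iff_ae_notMem.2 (h.ae_mem.mono fun r hr hr' => ?_)
      exact absurd (lt_of_le_of_lt ht hr') (not_lt.2 hr.2.le)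
    simp [this]
  rw [h3, add_zero]
  rfl

/-- Moments are controlled by the tail. -/
theorem moment_le (h : IsTailDoubling μ) : ∃ C > (0 : ℝ), ∀ k : ℕ,
    ∫ r, r ^ k ∂μ ≤ C * μ.real (Ioi (1 - 1 / ((k : ℝ) + 1))) := by
  have := h.isFinite
  obtain ⟨C, hC, β, hβ⟩ := h.tail_le
  set E : ℝ := 2 ^ β * (β.factorial * Real.exp 1 + 1) with hE
  have hE0 : 0 < E := by positivity
  have hbase : ∀ m : ℕ, ∀ r ∈ Icc (0 : ℝ) 1,
      (1 + ((m : ℝ) + 1) * (1 - r)) ^ β * r ^ m ≤ E := by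
    intro m r hr
    have h1 := pow_mul_pow_le_factorial hr.1 hr.2 m β
    set y := ((m : ℝ) + 1) * (1 - r) with hy
    have hy0 : 0 ≤ y := mul_nonneg (by positivity) (by linarith [hr.2])
    have h2 : (1 + y) ^ β ≤ 2 ^ β * (y ^ β + 1) := by
      calc (1 + y) ^ β ≤ (2 * max 1 y) ^ β := by
            gcongr; linarith [le_max_left 1 y, le_max_right 1 y]
        _ = 2 ^ β * (max 1 y) ^ β := mul_pow _ _ _
        _ ≤ 2 ^ β * (y ^ β + 1) := by
            gcongr
            rcases max_cases 1 y with ⟨h, _⟩ | ⟨h, _⟩ <;> rw [h]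
            · simp; positivity
            · linarith
    have h3 : r ^ m ≤ 1 := pow_le_one₀ hr.1 hr.2
    have h4 : 0 ≤ r ^ m := pow_nonneg hr.1 _
    calc (1 + y) ^ β * r ^ m ≤ 2 ^ β * (y ^ β + 1) * r ^ m := by gcongr
      _ = 2 ^ β * (y ^ β * r ^ m + r ^ m) := by ring
      _ ≤ E := by rw [hE]; gcongr
  set D : ℝ := C * 2 ^ β * E * 2 with hD
  have hsucc : ∀ k : ℕ, ∫ r, r ^ (k + 1) ∂μ ≤ D * μ.real (Ioi (1 - 1 / ((k : ℝ) + 1 + 1))) := by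
    intro k
    set τ := μ.real (Ioi (1 - 1 / ((k : ℝ) + 1 + 1))) with hτ
    have hmem : 1 - 1 / ((k : ℝ) + 1 + 1) ∈ Ico (0 : ℝ) 1 := by
      have := one_sub_inv_mem_Ico (k + 1); push_cast at this; exact this
    have hτ0 : 0 ≤ τ := measureReal_nonneg
    -- The exponent is split as `t^k = t^m t^(k-m)` with `m` about `k/2`: `t^m` absorbs the
    -- polynomial growth of the tail away from `1` (`hbase`), and `∫_0^1 (k+1) t^(k-m) dt ≤ 2`
    -- remains.
    set m := (k + 1) / 2 with hm
    have hmk : m ≤ k := by omega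
    have hkm : k + 2 ≤ 2 * (m + 1) := by omega
    have hkm' : (k : ℝ) + 2 ≤ 2 * ((m : ℝ) + 1) := by exact_mod_cast hkm
    have hpt : ∀ t ∈ Ioo (0 : ℝ) 1, μ (Ioi t) * ENNReal.ofReal ((k + 1) * t ^ k) ≤
        ENNReal.ofReal (C * 2 ^ β * E * τ * (((k : ℝ) + 1) * t ^ (k - m))) := by
      intro t ht
      have ht0 := ht.1
      have ht1 : 0 ≤ 1 - t := by linarith [ht.2]
      rw [← ofReal_measureReal, ← ENNReal.ofReal_mul measureReal_nonneg]
      refine ENNReal.ofReal_le_ofReal ?_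
      have h1 := hβ t ⟨ht.1.le, ht.2⟩ _ hmem
      have h2 : (1 - t) / (1 - (1 - 1 / ((k : ℝ) + 1 + 1))) = ((k : ℝ) + 2) * (1 - t) := by
        rw [sub_sub_cancel]; field_simp; ring
      rw [h2] at h1
      have h3 : 1 + ((k : ℝ) + 2) * (1 - t) ≤ 2 * (1 + ((m : ℝ) + 1) * (1 - t)) := by
        nlinarith
      have h4 : t ^ k = t ^ m * t ^ (k - m) := by rw [← pow_add]; congr 1; omega
      have h5 := hbase m t ⟨ht.1.le, ht.2.le⟩
      calc μ.real (Ioi t) * ((k + 1) * t ^ k)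
          ≤ (C * (2 * (1 + ((m : ℝ) + 1) * (1 - t))) ^ β * τ) * ((k + 1) * t ^ k) := by
            refine mul_le_mul_of_nonneg_right (h1.trans ?_) (by positivity)
            gcongr
        _ = C * 2 ^ β * τ * ((k + 1) * t ^ (k - m)) *
            ((1 + ((m : ℝ) + 1) * (1 - t)) ^ β * t ^ m) := by rw [mul_pow, h4]; ring
        _ ≤ C * 2 ^ β * τ * ((k + 1) * t ^ (k - m)) * E := by gcongr
        _ = _ := by ring
    have hint : ∫ t in (0 : ℝ)..1, C * 2 ^ β * E * τ * (((k : ℝ) + 1) * t ^ (k - m)) ≤ D * τ := by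
      rw [intervalIntegral.integral_const_mul, intervalIntegral.integral_const_mul, integral_pow]
      have : ((k : ℝ) + 1) * ((1 ^ (k - m + 1) - 0 ^ (k - m + 1)) / (((k - m : ℕ) : ℝ) + 1)) ≤ 2 := by
        rw [one_pow, zero_pow (by omega), sub_zero, mul_one_div, div_le_iff₀ (by positivity)]
        have : k + 1 ≤ 2 * ((k - m) + 1) := by omega
        exact_mod_cast this
      calc _ ≤ C * 2 ^ β * E * τ * 2 := by gcongr
        _ = D * τ := by rw [hD]; ring
    have hfin : ENNReal.ofReal (∫ r, r ^ (k + 1) ∂μ) ≤ ENNReal.ofReal (D * τ) := by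
      rw [h.lintegral_pow_eq k]
      refine (setLIntegral_mono' measurableSet_Ioo hpt).trans ?_
      rw [← ofReal_integral_eq_lintegral_ofReal, ← integral_Ioc_eq_integral_Ioo,
        ← intervalIntegral.integral_of_le zero_le_one]
      · exact ENNReal.ofReal_le_ofReal hint
      · exact ((by fun_prop : Continuous fun t : ℝ =>
          C * 2 ^ β * E * τ * (((k : ℝ) + 1) * t ^ (k - m))).integrableOn_Icc
            (a := 0) (b := 1)).mono_set Ioo_subset_Icc_self
      · refine (ae_restrict_iff' measurableSet_Ioo).2 (Filter.Eventually.of_forall fun t ht => ?_)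
        have := ht.1
        simp only [Pi.zero_apply]
        positivity
    exact (ENNReal.ofReal_le_ofReal_iff (by positivity)).1 hfin
  refine ⟨max D 1, by positivity, fun k => ?_⟩
  rcases k with _ | k
  · have h1 : ∫ r, r ^ 0 ∂μ = μ.real (Ioi 0) := by
      simp only [pow_zero, integral_const, smul_eq_mul, mul_one]
      refine measureReal_congr ?_
      exact h.ae_mem.mono fun r hr => propext ⟨fun _ => hr.1, fun _ => trivial⟩
    rw [h1]
    simp only [Nat.cast_zero, zero_add, div_one, sub_self]
    exact le_mul_of_one_le_left measureReal_nonneg (le_max_right _ _)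
  · refine (hsucc k).trans ?_
    push_cast
    gcongr
    exact le_max_left _ _

/-- Moments dominate the tail. -/
theorem le_moment (h : IsTailDoubling μ) : ∃ C > (0 : ℝ), ∀ n : ℕ,
    μ.real (Ioi (1 - 1 / ((n : ℝ) + 1))) ≤ C * ∫ r, r ^ (2 * n + 1) ∂μ := by
  have := h.isFinite
  obtain ⟨C, hC⟩ := h.doubling
  refine ⟨(max C 1) * Real.exp 1, by positivity, fun n => ?_⟩
  have h1 := hC _ (one_sub_inv_mem_Ico n)
  -- One doubling step from `1 - 1/(n+1)` lands exactly at `ρ = 1 - 1/(2n+2)`, and `r^(2n+1) ≥ 1/e`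
  -- for `r > ρ`.
  have h2 : (1 + (1 - 1 / ((n : ℝ) + 1))) / 2 = 1 - 1 / (((2 * n + 1 : ℕ) : ℝ) + 1) := by
    push_cast; field_simp; ring
  rw [h2] at h1
  set ρ := 1 - 1 / (((2 * n + 1 : ℕ) : ℝ) + 1) with hρ
  have hρ0 : 0 ≤ ρ := (one_sub_inv_mem_Ico _).1
  have h3 : Real.exp (-1) * μ.real (Ioi ρ) ≤ ∫ r, r ^ (2 * n + 1) ∂μ := by
    calc Real.exp (-1) * μ.real (Ioi ρ) = ∫ r in Ioi ρ, Real.exp (-1) ∂μ := by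
          simp [mul_comm]
      _ ≤ ∫ r in Ioi ρ, r ^ (2 * n + 1) ∂μ := by
          refine setIntegral_mono_on (by simp) ?_ measurableSet_Ioi fun r hr => ?_
          · exact (h.integrable_of_continuous (by fun_prop)).integrableOn
          · exact (exp_neg_one_le_pow (2 * n + 1)).trans
              (pow_le_pow_left₀ hρ0 (le_of_lt hr) _)
      _ ≤ ∫ r, r ^ (2 * n + 1) ∂μ :=
          setIntegral_le_integral (h.integrable_of_continuous (by fun_prop))
            (h.ae_mem.mono fun r hr => pow_nonneg hr.1.le _)
  have h4 : Real.exp 1 * Real.exp (-1) = 1 := by rw [← Real.exp_add]; simp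
  calc μ.real (Ioi (1 - 1 / ((n : ℝ) + 1))) ≤ C * μ.real (Ioi ρ) := h1
    _ ≤ max C 1 * μ.real (Ioi ρ) := by gcongr; exact le_max_left _ _
    _ = max C 1 * Real.exp 1 * (Real.exp (-1) * μ.real (Ioi ρ)) := by
        linear_combination (- max C 1 * μ.real (Ioi ρ)) * h4
    _ ≤ _ := by gcongr

end IsTailDoubling

/-! ### Forward differences of products and reciprocals -/

/-- Induction on `k` through `Δ(fg) = Δf g + f Δg + Δf Δg`. The majorants are part of the induction,
since passing from `f` to `Δf` replaces `φ` by `φ/(n+1)`; the last term gains one power of `n+1` too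
many, which is discarded. -/
theorem fwdDiff_iter_mul_bound (k : ℕ) : ∀ (f g φ ψ : ℕ → ℝ), (∀ n, 0 ≤ φ n) → (∀ n, 0 ≤ ψ n) →
    (∀ j ≤ k, ∃ C : ℝ, ∀ n : ℕ, |(fwdDiff 1)^[j] f n| ≤ C * (φ n / ((n : ℝ) + 1) ^ j)) →
    (∀ j ≤ k, ∃ C : ℝ, ∀ n : ℕ, |(fwdDiff 1)^[j] g n| ≤ C * (ψ n / ((n : ℝ) + 1) ^ j)) →
    ∃ C : ℝ, ∀ n : ℕ, |(fwdDiff 1)^[k] (f * g) n| ≤ C * (φ n * ψ n / ((n : ℝ) + 1) ^ k) := by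
  induction k with
  | zero =>
    intro f g φ ψ hφ hψ hf hg
    obtain ⟨C, hC⟩ := hf 0 le_rfl
    obtain ⟨D, hD⟩ := hg 0 le_rfl
    refine ⟨C * D, fun n => ?_⟩
    have h1 := hC n
    have h2 := hD n
    simp only [Function.iterate_zero, id, pow_zero, div_one, Pi.mul_apply, abs_mul] at h1 h2 ⊢
    calc |f n| * |g n| ≤ (C * φ n) * (D * ψ n) :=
          mul_le_mul h1 h2 (abs_nonneg _) ((abs_nonneg _).trans h1)
      _ = _ := by ring
  | succ k ih =>
    intro f g φ ψ hφ hψ hf hg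
    have hmono : ∀ (u χ : ℕ → ℝ),
        (∀ j ≤ k + 1, ∃ C : ℝ, ∀ n : ℕ, |(fwdDiff 1)^[j] u n| ≤ C * (χ n / ((n : ℝ) + 1) ^ j)) →
        ∀ j ≤ k, ∃ C : ℝ, ∀ n : ℕ, |(fwdDiff 1)^[j] (fwdDiff 1 u) n| ≤
          C * ((χ n / ((n : ℝ) + 1)) / ((n : ℝ) + 1) ^ j) := by
      intro u χ hu j hj
      obtain ⟨C, hC⟩ := hu (j + 1) (by omega)
      refine ⟨C, fun n => ?_⟩
      have := hC n
      rwa [Function.iterate_succ_apply, pow_succ', ← div_div] at this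
    have hφ' : ∀ n : ℕ, 0 ≤ φ n / ((n : ℝ) + 1) := fun n => div_nonneg (hφ n) (by positivity)
    have hψ' : ∀ n : ℕ, 0 ≤ ψ n / ((n : ℝ) + 1) := fun n => div_nonneg (hψ n) (by positivity)
    have hf0 := fun j (hj : j ≤ k) => hf j (hj.trans (Nat.le_succ k))
    have hg0 := fun j (hj : j ≤ k) => hg j (hj.trans (Nat.le_succ k))
    obtain ⟨C₁, h₁⟩ := ih (fwdDiff 1 f) g _ ψ hφ' hψ (hmono f φ hf) hg0
    obtain ⟨C₂, h₂⟩ := ih f (fwdDiff 1 g) φ _ hφ hψ' hf0 (hmono g ψ hg)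
    obtain ⟨C₃, h₃⟩ := ih (fwdDiff 1 f) (fwdDiff 1 g) _ _ hφ' hψ' (hmono f φ hf) (hmono g ψ hg)
    refine ⟨C₁ + C₂ + |C₃|, fun n => ?_⟩
    have hD : fwdDiff 1 (f * g) =
        fwdDiff 1 f * g + f * fwdDiff 1 g + fwdDiff 1 f * fwdDiff 1 g := by
      ext m
      simp only [fwdDiff, Pi.mul_apply, Pi.add_apply]
      ring
    rw [Function.iterate_succ_apply, hD, fwdDiff_iter_add, fwdDiff_iter_add]
    set q : ℝ := φ n * ψ n / ((n : ℝ) + 1) ^ (k + 1) with hq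
    have hq0 : 0 ≤ q := div_nonneg (mul_nonneg (hφ n) (hψ n)) (by positivity)
    have e1 : φ n / ((n : ℝ) + 1) * ψ n / ((n : ℝ) + 1) ^ k = q := by
      rw [hq, pow_succ]; field_simp
    have e2 : φ n * (ψ n / ((n : ℝ) + 1)) / ((n : ℝ) + 1) ^ k = q := by
      rw [hq, pow_succ]; field_simp
    have e3 : φ n / ((n : ℝ) + 1) * (ψ n / ((n : ℝ) + 1)) / ((n : ℝ) + 1) ^ k =
        q / ((n : ℝ) + 1) := by
      rw [hq, pow_succ]; field_simp
    have h1 := h₁ n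
    have h2 := h₂ n
    have h3 := h₃ n
    rw [e1] at h1
    rw [e2] at h2
    rw [e3] at h3
    have h4 : C₃ * (q / ((n : ℝ) + 1)) ≤ |C₃| * q := by
      have : q / ((n : ℝ) + 1) ≤ q := div_le_self hq0 (by linarith [n.cast_nonneg (α := ℝ)])
      exact mul_le_mul (le_abs_self _) this (by positivity) (abs_nonneg _)
    calc _ ≤ |(fwdDiff 1)^[k] (fwdDiff 1 f * g) n| + |(fwdDiff 1)^[k] (f * fwdDiff 1 g) n| +
          |(fwdDiff 1)^[k] (fwdDiff 1 f * fwdDiff 1 g) n| := by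
          simp only [Pi.add_apply]
          exact abs_add_three _ _ _
      _ ≤ (C₁ + C₂ + |C₃|) * q := by linarith

/-- From `Δ(1/c) n = -Δc n · (1/c n)(1/c (n+1))`: the `k+1`-st difference of `1/c` is the `k`-th
difference of a product whose factors are controlled by `hdiff` and by strong induction. The
hypothesis `hshift` makes `1/c (n+1)` as good as `1/c n`. -/
theorem fwdDiff_iter_inv_bound {c : ℕ → ℝ} (hc : ∀ n, 0 < c n)
    (hdiff : ∀ j, ∃ C : ℝ, ∀ n : ℕ, |(fwdDiff 1)^[j] c n| ≤ C * (c n / ((n : ℝ) + 1) ^ j))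
    (hshift : ∃ C : ℝ, ∀ n, c n ≤ C * c (n + 1)) (k : ℕ) :
    ∃ C : ℝ, ∀ n : ℕ, |(fwdDiff 1)^[k] (fun n => (c n)⁻¹) n| ≤
      C * ((c n)⁻¹ / ((n : ℝ) + 1) ^ k) := by
  set b : ℕ → ℝ := fun n => (c n)⁻¹ with hb
  have hb0 : ∀ n, 0 < b n := fun n => inv_pos.2 (hc n)
  obtain ⟨S, hS⟩ := hshift
  induction k using Nat.strong_induction_on with
  | _ k ih =>
  rcases k with _ | k
  · refine ⟨1, fun n => ?_⟩
    simp [hb, abs_of_pos (hc n)]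
  have hDb : fwdDiff 1 b = -(fwdDiff 1 c * (b * fun n => b (n + 1))) := by
    ext n
    have h1 := (hc n).ne'
    have h2 := (hc (n + 1)).ne'
    simp only [fwdDiff, hb, Pi.neg_apply, Pi.mul_apply]
    field_simp
    ring
  have hbS : ∀ n, b (n + 1) ≤ S * b n := by
    intro n
    have h1 := hc n
    have h2 := hc (n + 1)
    simp only [hb]
    rw [← div_eq_mul_inv, inv_eq_one_div, div_le_div_iff₀ h2 h1, one_mul]
    exact hS n
  have hih : ∀ j ≤ k, ∃ C : ℝ, ∀ n : ℕ, |(fwdDiff 1)^[j] b n| ≤ C * (b n / ((n : ℝ) + 1) ^ j) :=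
    fun j hj => ih j (by omega)
  have hihS : ∀ j ≤ k, ∃ C : ℝ, ∀ n : ℕ, |(fwdDiff 1)^[j] (fun n => b (n + 1)) n| ≤
      C * (b n / ((n : ℝ) + 1) ^ j) := by
    intro j hj
    obtain ⟨C, hC⟩ := hih j hj
    refine ⟨|C| * S, fun n => ?_⟩
    rw [fwdDiff_iter_comp_add]
    calc |(fwdDiff 1)^[j] b (n + 1)| ≤ C * (b (n + 1) / (((n + 1 : ℕ) : ℝ) + 1) ^ j) := hC (n + 1)
      _ ≤ |C| * (S * b n / ((n : ℝ) + 1) ^ j) := by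
          refine mul_le_mul (le_abs_self _) ?_ (div_nonneg (hb0 _).le (by positivity))
            (abs_nonneg _)
          have := (hb0 (n + 1)).le.trans (hbS n)
          refine div_le_div₀ this (hbS n) (by positivity) ?_
          gcongr
          linarith
      _ = _ := by ring
  have hprod : ∀ j ≤ k, ∃ C : ℝ, ∀ n : ℕ, |(fwdDiff 1)^[j] (b * fun n => b (n + 1)) n| ≤
      C * (b n * b n / ((n : ℝ) + 1) ^ j) := fun j hj =>
    fwdDiff_iter_mul_bound j _ _ b b (fun n => (hb0 n).le) (fun n => (hb0 n).le)
      (fun i hi => hih i (hi.trans hj)) (fun i hi => hihS i (hi.trans hj))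
  have hDc : ∀ j ≤ k, ∃ C : ℝ, ∀ n : ℕ, |(fwdDiff 1)^[j] (fwdDiff 1 c) n| ≤
      C * ((c n / ((n : ℝ) + 1)) / ((n : ℝ) + 1) ^ j) := by
    intro j _
    obtain ⟨C, hC⟩ := hdiff (j + 1)
    refine ⟨C, fun n => ?_⟩
    have := hC n
    rwa [Function.iterate_succ_apply, pow_succ', ← div_div] at this
  obtain ⟨C, hC⟩ := fwdDiff_iter_mul_bound k _ _ (fun n => c n / ((n : ℝ) + 1))
    (fun n => b n * b n) (fun n => div_nonneg (hc n).le (by positivity))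
    (fun n => mul_nonneg (hb0 n).le (hb0 n).le) hDc hprod
  refine ⟨C, fun n => ?_⟩
  have hneg : (fwdDiff 1)^[k] (-(fwdDiff 1 c * (b * fun n => b (n + 1)))) n =
      -(fwdDiff 1)^[k] (fwdDiff 1 c * (b * fun n => b (n + 1))) n := by
    have := fwdDiff_iter_const_smul (1 : ℕ) (-1 : ℝ) (fwdDiff 1 c * (b * fun n => b (n + 1))) k
    rw [neg_one_smul, neg_one_smul] at this
    rw [this]
    rfl
  rw [Function.iterate_succ_apply, hDb, hneg, abs_neg]
  refine (hC n).trans_eq ?_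
  have h1 := (hc n).ne'
  simp only [hb]
  rw [pow_succ]
  field_simp

/-! ### The coefficients of the kernel -/

/-- The Taylor coefficients of the Bergman kernel induced by `μ`. -/
noncomputable def kernelCoeff (μ : Measure ℝ) (n : ℕ) : ℝ := (2 * ∫ r, r ^ (2 * n + 1) ∂μ)⁻¹

namespace IsTailDoubling

variable {μ : Measure ℝ}

theorem moment_pos (h : IsTailDoubling μ) (n : ℕ) : 0 < ∫ r, r ^ (2 * n + 1) ∂μ := by
  obtain ⟨C, hC, hle⟩ := h.le_moment
  have := (h.tail_pos _ (one_sub_inv_mem_Ico n)).trans_le (hle n)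
  exact pos_of_mul_pos_right this hC.le

theorem kernelCoeff_pos (h : IsTailDoubling μ) (n : ℕ) : 0 < kernelCoeff μ n :=
  inv_pos.2 (mul_pos two_pos (h.moment_pos n))

theorem kernelCoeff_le (h : IsTailDoubling μ) : ∃ C > (0 : ℝ), ∀ n : ℕ,
    kernelCoeff μ n ≤ C / μ.real (Ioi (1 - 1 / ((n : ℝ) + 1))) := by
  obtain ⟨C, hC, hle⟩ := h.le_moment
  refine ⟨C, hC, fun n => ?_⟩
  have h1 := h.moment_pos n
  have h2 := h.tail_pos _ (one_sub_inv_mem_Ico n)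
  unfold kernelCoeff
  rw [inv_eq_one_div, div_le_div_iff₀ (by positivity) h2]
  nlinarith [hle n, mul_pos hC h1]

theorem le_kernelCoeff (h : IsTailDoubling μ) : ∃ C > (0 : ℝ), ∀ n : ℕ,
    1 / μ.real (Ioi (1 - 1 / ((n : ℝ) + 1))) ≤ C * kernelCoeff μ n := by
  have := h.isFinite
  obtain ⟨C, hC, hle⟩ := h.moment_le
  refine ⟨2 * C, by positivity, fun n => ?_⟩
  have h1 := h.moment_pos n
  have h2 := h.tail_pos _ (one_sub_inv_mem_Ico n)
  have h3 := hle (2 * n + 1)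
  have h4 : μ.real (Ioi (1 - 1 / (((2 * n + 1 : ℕ) : ℝ) + 1))) ≤
      μ.real (Ioi (1 - 1 / ((n : ℝ) + 1))) := by
    refine tail_antitone μ ?_
    have : 1 / (((2 * n + 1 : ℕ) : ℝ) + 1) ≤ 1 / ((n : ℝ) + 1) := by
      refine one_div_le_one_div_of_le (by positivity) ?_
      push_cast; linarith [n.cast_nonneg (α := ℝ)]
    linarith
  unfold kernelCoeff
  rw [← div_eq_mul_inv, div_le_div_iff₀ h2 (by positivity)]
  nlinarith [mul_le_mul_of_nonneg_left h4 hC.le]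

/-- This is `tail_le` at the points `1 - 1/(n+1)`. The exponent `β` decides later how many
summations by parts are needed. -/
theorem kernelCoeff_growth (h : IsTailDoubling μ) : ∃ C > (0 : ℝ), ∃ β : ℕ, ∀ m n : ℕ,
    kernelCoeff μ n ≤ C * (1 + ((n : ℝ) + 1) / ((m : ℝ) + 1)) ^ β * kernelCoeff μ m := by
  obtain ⟨A, hA, h1⟩ := h.kernelCoeff_le
  obtain ⟨B, hB, h2⟩ := h.le_kernelCoeff
  obtain ⟨C, hC, β, h3⟩ := h.tail_le
  refine ⟨A * C * B, by positivity, β, fun m n => ?_⟩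
  have hm := h.tail_pos _ (one_sub_inv_mem_Ico m)
  have hn := h.tail_pos _ (one_sub_inv_mem_Ico n)
  have h4 := h3 _ (one_sub_inv_mem_Ico m) _ (one_sub_inv_mem_Ico n)
  have e : (1 - (1 - 1 / ((m : ℝ) + 1))) / (1 - (1 - 1 / ((n : ℝ) + 1))) =
      ((n : ℝ) + 1) / ((m : ℝ) + 1) := by
    rw [sub_sub_cancel, sub_sub_cancel]; field_simp
  rw [e] at h4
  set x := (1 + ((n : ℝ) + 1) / ((m : ℝ) + 1)) ^ β with hx
  have hx0 : 0 < x := by positivity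
  calc kernelCoeff μ n ≤ A / μ.real (Ioi (1 - 1 / ((n : ℝ) + 1))) := h1 n
    _ ≤ A * (C * x * (1 / μ.real (Ioi (1 - 1 / ((m : ℝ) + 1))))) := by
        rw [div_eq_mul_one_div]
        gcongr
        rw [mul_one_div, div_le_div_iff₀ hn hm, one_mul]
        exact h4
    _ ≤ A * (C * x * (B * kernelCoeff μ m)) := by gcongr; exact h2 m
    _ = _ := by ring

/-- Raising `n` by one multiplies the integrand by `r^2`, so each difference multiplies it by `r^2 -
1`. -/
theorem fwdDiff_moment (h : IsTailDoubling μ) (j : ℕ) : ∀ n : ℕ,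
    (fwdDiff 1)^[j] (fun n : ℕ => 2 * ∫ r, r ^ (2 * n + 1) ∂μ) n =
      2 * ∫ r, r ^ (2 * n + 1) * (r ^ 2 - 1) ^ j ∂μ := by
  induction j with
  | zero => intro n; simp
  | succ j ih =>
    intro n
    rw [Function.iterate_succ_apply']
    unfold fwdDiff at ih ⊢
    have hI : ∀ n : ℕ, Integrable (fun r : ℝ => r ^ (2 * n + 1) * (r ^ 2 - 1) ^ j) μ :=
      fun n => h.integrable_of_continuous (by fun_prop)
    rw [ih, ih, ← mul_sub, ← integral_sub (hI _) (hI _)]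
    congr 1
    refine integral_congr_ae (Filter.Eventually.of_forall fun r => ?_)
    simp only
    ring

/-- Write `r^(2n+1) = r^n · r^(n+1)` and `|r^2 - 1| ≤ 2(1-r)`. The factor `r^n` pays for
`((n+1)(1-r))^j`, and the moment of order `n` that remains is comparable to the one of order `2n+1`,
both being governed by the same tail. -/
theorem fwdDiff_moment_bound (h : IsTailDoubling μ) (j : ℕ) : ∃ C : ℝ, ∀ n : ℕ,
    |(fwdDiff 1)^[j] (fun n : ℕ => 2 * ∫ r, r ^ (2 * n + 1) ∂μ) n| ≤
      C * ((2 * ∫ r, r ^ (2 * n + 1) ∂μ) / ((n : ℝ) + 1) ^ j) := by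
  obtain ⟨A, hA, h1⟩ := h.moment_le
  obtain ⟨B, hB, h2⟩ := h.le_moment
  set E : ℝ := 2 ^ j * (j.factorial * Real.exp 1) with hE
  have hE0 : 0 < E := by positivity
  refine ⟨E * (A * B), fun n => ?_⟩
  rw [h.fwdDiff_moment j n, abs_mul, abs_of_pos (two_pos : (0 : ℝ) < 2)]
  have hn : (0 : ℝ) < ((n : ℝ) + 1) ^ j := by positivity
  have h3 : |∫ r, r ^ (2 * n + 1) * (r ^ 2 - 1) ^ j ∂μ| ≤
      ∫ r, E / ((n : ℝ) + 1) ^ j * r ^ n ∂μ := by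
    rw [← Real.norm_eq_abs]
    refine norm_integral_le_of_norm_le
      ((h.integrable_of_continuous (continuous_pow n)).const_mul _) ?_
    refine h.ae_mem.mono fun r hr => ?_
    have hr0 := hr.1
    have hr1 : 0 ≤ 1 - r := by linarith [hr.2]
    have h4 := pow_mul_pow_le_factorial hr.1.le hr.2.le n j
    have h5 : |r ^ 2 - 1| ≤ 2 * (1 - r) := by
      rw [abs_le]; constructor <;> nlinarith
    have h6 : r ^ (n + 1) ≤ r ^ n := pow_le_pow_of_le_one hr0.le hr.2.le (Nat.le_succ n)
    rw [norm_mul, norm_pow, norm_pow, Real.norm_eq_abs, Real.norm_eq_abs, abs_of_pos hr0,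
      div_mul_eq_mul_div, le_div_iff₀ hn]
    calc r ^ (2 * n + 1) * |r ^ 2 - 1| ^ j * ((n : ℝ) + 1) ^ j
        ≤ r ^ (2 * n + 1) * (2 * (1 - r)) ^ j * ((n : ℝ) + 1) ^ j := by gcongr
      _ = 2 ^ j * ((((n : ℝ) + 1) * (1 - r)) ^ j * r ^ n) * r ^ (n + 1) := by
          rw [show 2 * n + 1 = n + (n + 1) by ring, pow_add, mul_pow, mul_pow]; ring
      _ ≤ 2 ^ j * (j.factorial * Real.exp 1) * r ^ n := by gcongr
      _ = E * r ^ n := by rw [hE]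
  rw [integral_const_mul] at h3
  have h7 : ∫ r, r ^ n ∂μ ≤ A * (B * ∫ r, r ^ (2 * n + 1) ∂μ) :=
    (h1 n).trans (by gcongr; exact h2 n)
  calc 2 * |∫ r, r ^ (2 * n + 1) * (r ^ 2 - 1) ^ j ∂μ|
      ≤ 2 * (E / ((n : ℝ) + 1) ^ j * (A * (B * ∫ r, r ^ (2 * n + 1) ∂μ))) := by
        gcongr; exact h3.trans (by gcongr)
    _ = _ := by ring

theorem fwdDiff_kernelCoeff_bound (h : IsTailDoubling μ) (k : ℕ) : ∃ C : ℝ, ∀ n : ℕ,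
    |(fwdDiff 1)^[k] (kernelCoeff μ) n| ≤ C * (kernelCoeff μ n / ((n : ℝ) + 1) ^ k) := by
  refine fwdDiff_iter_inv_bound (c := fun n : ℕ => 2 * ∫ r, r ^ (2 * n + 1) ∂μ)
    (fun n => mul_pos two_pos (h.moment_pos n)) h.fwdDiff_moment_bound ?_ k
  obtain ⟨C, hC, β, hg⟩ := h.kernelCoeff_growth
  refine ⟨C * 3 ^ β, fun n => ?_⟩
  have h1 := hg n (n + 1)
  have hb := h.kernelCoeff_pos n
  have h2 : 1 + (((n + 1 : ℕ) : ℝ) + 1) / ((n : ℝ) + 1) ≤ 3 := by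
    have : (((n + 1 : ℕ) : ℝ) + 1) / ((n : ℝ) + 1) ≤ 2 := by
      rw [div_le_iff₀ (by positivity)]; push_cast; linarith [n.cast_nonneg (α := ℝ)]
    linarith
  have h3 : kernelCoeff μ (n + 1) ≤ C * 3 ^ β * kernelCoeff μ n := h1.trans (by gcongr)
  have p1 := h.moment_pos n
  have p2 := h.moment_pos (n + 1)
  unfold kernelCoeff at h3
  rw [← div_eq_mul_inv, inv_eq_one_div, div_le_div_iff₀ (by positivity) (by positivity),
    one_mul] at h3
  exact h3

end IsTailDoubling

/-! ### Size of the kernel -/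

/-- One summation by parts. -/
theorem one_sub_mul_tsum {a : ℕ → ℝ} {w : ℂ} (h0 : Summable fun n => (a n : ℂ) * w ^ n)
    (h1 : Summable fun n => ((fwdDiff 1 a n : ℝ) : ℂ) * w ^ n) :
    (1 - w) * ∑' n, (a n : ℂ) * w ^ n = a 0 + w * ∑' n, ((fwdDiff 1 a n : ℝ) : ℂ) * w ^ n := by
  have h2 : ∑' n, (a n : ℂ) * w ^ n = a 0 + w * ∑' n, (a (n + 1) : ℂ) * w ^ n := by
    rw [h0.tsum_eq_zero_add, ← tsum_mul_left]
    simp only [pow_zero, mul_one]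
    congr 1
    exact tsum_congr fun n => by ring
  have h3 : ∑' n, (a (n + 1) : ℂ) * w ^ n =
      ∑' n, ((fwdDiff 1 a n : ℝ) : ℂ) * w ^ n + ∑' n, (a n : ℂ) * w ^ n := by
    rw [← h1.tsum_add h0]
    refine tsum_congr fun n => ?_
    simp only [fwdDiff]
    push_cast
    ring
  rw [h3] at h2
  linear_combination h2

/-- Summation by parts `k` times. Each round divides by `|1-w|` and leaves one boundary term at
index `0`; the factor `w` in front of the remainder is dropped by `‖w‖ ≤ 1`. -/
theorem norm_tsum_le_fwdDiff {a : ℕ → ℝ} {w : ℂ} (hw : ‖w‖ ≤ 1) (hw1 : 0 < ‖1 - w‖)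
    (hs : ∀ j, Summable fun n => (((fwdDiff 1)^[j] a n : ℝ) : ℂ) * w ^ n) (k : ℕ) :
    ‖∑' n, (a n : ℂ) * w ^ n‖ ≤
      ∑ j ∈ Finset.range k, |(fwdDiff 1)^[j] a 0| / ‖1 - w‖ ^ (j + 1) +
        ‖∑' n, (((fwdDiff 1)^[k] a n : ℝ) : ℂ) * w ^ n‖ / ‖1 - w‖ ^ k := by
  induction k with
  | zero => simp
  | succ k ih =>
    refine ih.trans ?_
    rw [Finset.sum_range_succ, add_assoc]
    gcongr
    have h1 := hs (k + 1)
    rw [Function.iterate_succ_apply'] at h1 ⊢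
    have h2 := congrArg norm (one_sub_mul_tsum (hs k) h1)
    rw [norm_mul] at h2
    set T := ‖∑' n, (((fwdDiff 1)^[k] a n : ℝ) : ℂ) * w ^ n‖ with hT
    have h3 : ‖1 - w‖ * T ≤ |(fwdDiff 1)^[k] a 0| +
        ‖∑' n, ((fwdDiff 1 ((fwdDiff 1)^[k] a) n : ℝ) : ℂ) * w ^ n‖ := by
      rw [h2]
      refine (norm_add_le _ _).trans ?_
      rw [Complex.norm_real, Real.norm_eq_abs, norm_mul]
      gcongr
      exact mul_le_of_le_one_left (norm_nonneg _) hw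
    rw [← add_div, div_le_div_iff₀ (by positivity) (by positivity), pow_succ']
    calc T * (‖1 - w‖ * ‖1 - w‖ ^ k) = (‖1 - w‖ * T) * ‖1 - w‖ ^ k := by ring
      _ ≤ _ := by gcongr

/-- Telescoping, from `1/x^2 ≤ 2(1/x - 1/(x+1))` for `x ≥ 1`. -/
theorem sum_inv_sq_le (m M : ℕ) :
    ∑ n ∈ Finset.range M, 1 / ((n : ℝ) + m + 1) ^ 2 ≤ 2 / ((m : ℝ) + 1) := by
  have key : ∑ n ∈ Finset.range M, 1 / ((n : ℝ) + m + 1) ^ 2 ≤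
      2 * (1 / ((m : ℝ) + 1) - 1 / ((M : ℝ) + m + 1)) := by
    induction M with
    | zero => simp
    | succ M ih =>
      rw [Finset.sum_range_succ]
      have h : 1 / ((M : ℝ) + m + 1) ^ 2 ≤
          2 * (1 / ((M : ℝ) + m + 1) - 1 / (((M + 1 : ℕ) : ℝ) + m + 1)) := by
        push_cast
        have hx : (1 : ℝ) ≤ (M : ℝ) + m + 1 := by
          linarith [M.cast_nonneg (α := ℝ), m.cast_nonneg (α := ℝ)]
        rw [show (M : ℝ) + 1 + m + 1 = ((M : ℝ) + m + 1) + 1 by ring]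
        set x := (M : ℝ) + m + 1
        have e : 2 * (1 / x - 1 / (x + 1)) = 2 / (x * (x + 1)) := by field_simp; ring
        rw [e, div_le_div_iff₀ (by positivity) (by positivity)]
        nlinarith
      linarith
  refine key.trans ?_
  have : 0 ≤ 1 / ((M : ℝ) + m + 1) := by positivity
  rw [show (2 : ℝ) / ((m : ℝ) + 1) = 2 * (1 / ((m : ℝ) + 1)) by ring]
  linarith

/-- The Bergman kernel induced by `μ`, as a function of `conj z * ζ`. -/
noncomputable def kernelSeries (μ : Measure ℝ) (w : ℂ) : ℂ := ∑' n, (kernelCoeff μ n : ℂ) * w ^ n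

namespace IsTailDoubling

variable {μ : Measure ℝ}

theorem kernelCoeff_le_of_le (h : IsTailDoubling μ) : ∃ C > (0 : ℝ), ∀ m n : ℕ, n ≤ m →
    kernelCoeff μ n ≤ C * kernelCoeff μ m := by
  obtain ⟨C, hC, β, hg⟩ := h.kernelCoeff_growth
  refine ⟨C * 2 ^ β, by positivity, fun m n hnm => (hg m n).trans ?_⟩
  have := h.kernelCoeff_pos m
  have h1 : ((n : ℝ) + 1) / ((m : ℝ) + 1) ≤ 1 := by
    rw [div_le_one (by positivity)]; gcongr
  gcongr
  linarith

theorem exists_fwdDiff_kernelCoeff_le (h : IsTailDoubling μ) (j m : ℕ) : ∃ C : ℝ, ∃ β : ℕ,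
    ∀ n : ℕ, |(fwdDiff 1)^[j] (kernelCoeff μ) (n + m)| ≤ C * ((n : ℝ) + 2) ^ β := by
  obtain ⟨A, hA⟩ := h.fwdDiff_kernelCoeff_bound j
  obtain ⟨C, hC, β, hg⟩ := h.kernelCoeff_growth
  refine ⟨|A| * (C * kernelCoeff μ m), β, fun n => (hA (n + m)).trans ?_⟩
  have hb := h.kernelCoeff_pos (n + m)
  have hm := h.kernelCoeff_pos m
  have h1 : kernelCoeff μ (n + m) / (((n + m : ℕ) : ℝ) + 1) ^ j ≤ kernelCoeff μ (n + m) :=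
    div_le_self hb.le (one_le_pow₀ (by linarith [(n + m).cast_nonneg (α := ℝ)]))
  have h2 : 1 + (((n + m : ℕ) : ℝ) + 1) / ((m : ℝ) + 1) ≤ (n : ℝ) + 2 := by
    have : (((n + m : ℕ) : ℝ) + 1) / ((m : ℝ) + 1) ≤ (n : ℝ) + 1 := by
      rw [div_le_iff₀ (by positivity)]
      push_cast
      nlinarith [n.cast_nonneg (α := ℝ), m.cast_nonneg (α := ℝ)]
    linarith
  calc A * (kernelCoeff μ (n + m) / (((n + m : ℕ) : ℝ) + 1) ^ j)
      ≤ |A| * kernelCoeff μ (n + m) :=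
        mul_le_mul (le_abs_self _) h1 (by positivity) (abs_nonneg _)
    _ ≤ |A| * (C * (1 + (((n + m : ℕ) : ℝ) + 1) / ((m : ℝ) + 1)) ^ β * kernelCoeff μ m) := by
        gcongr; exact hg m (n + m)
    _ ≤ |A| * (C * ((n : ℝ) + 2) ^ β * kernelCoeff μ m) := by gcongr
    _ = _ := by ring

theorem summable_fwdDiff (h : IsTailDoubling μ) (j m : ℕ) {x : ℝ} (h0 : 0 ≤ x) (h1 : x < 1) :
    Summable fun n : ℕ => |(fwdDiff 1)^[j] (kernelCoeff μ) (n + m)| * x ^ n := by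
  obtain ⟨C, β, hC⟩ := h.exists_fwdDiff_kernelCoeff_le j m
  have hs : Summable fun n : ℕ => |C| * (2 ^ (β - 1) * ((n : ℝ) ^ β * x ^ n + 2 ^ β * x ^ n)) := by
    refine Summable.mul_left _ (Summable.mul_left _ (Summable.add ?_ ?_))
    · exact summable_pow_mul_geometric_of_norm_lt_one β (by rwa [Real.norm_of_nonneg h0])
    · exact (summable_geometric_of_lt_one h0 h1).mul_left _
  refine Summable.of_nonneg_of_le (fun n => by positivity) (fun n => ?_) hs
  have h2 := add_pow_le (n.cast_nonneg (α := ℝ)) (zero_le_two) β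
  calc |(fwdDiff 1)^[j] (kernelCoeff μ) (n + m)| * x ^ n
      ≤ |C| * ((n : ℝ) + 2) ^ β * x ^ n := by
        gcongr
        exact (hC n).trans (by gcongr; exact le_abs_self _)
    _ ≤ |C| * (2 ^ (β - 1) * ((n : ℝ) ^ β + 2 ^ β)) * x ^ n := by gcongr
    _ = _ := by ring

theorem summable_kernelCoeff (h : IsTailDoubling μ) {x : ℝ} (h0 : 0 ≤ x) (h1 : x < 1) :
    Summable fun n : ℕ => kernelCoeff μ n * x ^ n := by
  refine (h.summable_fwdDiff 0 0 h0 h1).congr fun n => ?_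
  simp [abs_of_pos (h.kernelCoeff_pos n)]

theorem summable_kernelCoeff_complex (h : IsTailDoubling μ) {w : ℂ} (hw : ‖w‖ < 1) :
    Summable fun n : ℕ => (kernelCoeff μ n : ℂ) * w ^ n := by
  refine Summable.of_norm ((h.summable_kernelCoeff (norm_nonneg w) hw).congr fun n => ?_)
  rw [norm_mul, norm_pow, Complex.norm_real, Real.norm_of_nonneg (h.kernelCoeff_pos n).le]

theorem norm_tsum_tail_le (h : IsTailDoubling μ) : ∃ C > (0 : ℝ), ∃ β : ℕ,
    ∀ m : ℕ, ∀ w : ℂ, ‖w‖ < 1 →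
      ‖∑' n, (((fwdDiff 1)^[β] (kernelCoeff μ) (n + m) : ℝ) : ℂ) * w ^ n‖ ≤
        C * ((m : ℝ) + 1) * kernelCoeff μ m / ((m : ℝ) + 1) ^ β := by
  obtain ⟨C, hC, β, hg⟩ := h.kernelCoeff_growth
  obtain ⟨A, hA⟩ := h.fwdDiff_kernelCoeff_bound (β + 2)
  -- Two differences more than the growth exponent: `b_(n+m)` is at most of order `((n+m+1)/(m+1))^β
  -- b_m`, so the `(β+2)`-nd difference is `O((n+m+1)^(-2))`, summable uniformly in `w`. The `+ 1`
  -- only keeps the constant positive.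
  refine ⟨(|A| * C * 2 ^ β + 1) * 2, by positivity, β + 2, fun m w hw => ?_⟩
  have hm := h.kernelCoeff_pos m
  set Q : ℝ := |A| * C * 2 ^ β * kernelCoeff μ m / ((m : ℝ) + 1) ^ β with hQ
  have hQ0 : 0 ≤ Q := by positivity
  have hterm : ∀ n : ℕ, ‖(((fwdDiff 1)^[β + 2] (kernelCoeff μ) (n + m) : ℝ) : ℂ) * w ^ n‖ ≤
      Q * (1 / ((n : ℝ) + m + 1) ^ 2) := by
    intro n
    have hb := h.kernelCoeff_pos (n + m)
    have hx : (0 : ℝ) < (n : ℝ) + m + 1 := by positivity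
    have h1 : 1 + (((n + m : ℕ) : ℝ) + 1) / ((m : ℝ) + 1) ≤
        2 * (((n : ℝ) + m + 1) / ((m : ℝ) + 1)) := by
      have : 1 ≤ ((n : ℝ) + m + 1) / ((m : ℝ) + 1) := by
        rw [le_div_iff₀ (by positivity)]; linarith [n.cast_nonneg (α := ℝ)]
      push_cast
      linarith
    have h2 := hA (n + m)
    push_cast at h2
    rw [norm_mul, norm_pow, Complex.norm_real, Real.norm_eq_abs]
    calc |(fwdDiff 1)^[β + 2] (kernelCoeff μ) (n + m)| * ‖w‖ ^ n
        ≤ |(fwdDiff 1)^[β + 2] (kernelCoeff μ) (n + m)| :=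
          mul_le_of_le_one_right (abs_nonneg _) (pow_le_one₀ (norm_nonneg _) hw.le)
      _ ≤ A * (kernelCoeff μ (n + m) / ((n : ℝ) + m + 1) ^ (β + 2)) := h2
      _ ≤ |A| * (kernelCoeff μ (n + m) / ((n : ℝ) + m + 1) ^ (β + 2)) := by
          gcongr; exact le_abs_self _
      _ ≤ |A| * ((C * (2 * (((n : ℝ) + m + 1) / ((m : ℝ) + 1))) ^ β * kernelCoeff μ m) /
            ((n : ℝ) + m + 1) ^ (β + 2)) := by
          gcongr
          exact (hg m (n + m)).trans (by gcongr)
      _ = Q * (1 / ((n : ℝ) + m + 1) ^ 2) := by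
          rw [hQ, mul_pow, div_pow, pow_add]
          field_simp
  have hpart : ∀ M : ℕ, ∑ n ∈ Finset.range M, Q * (1 / ((n : ℝ) + m + 1) ^ 2) ≤
      Q * (2 / ((m : ℝ) + 1)) := by
    intro M
    rw [← Finset.mul_sum]
    exact mul_le_mul_of_nonneg_left (sum_inv_sq_le m M) hQ0
  have hsum := summable_of_sum_range_le (fun n => by positivity) hpart
  refine (tsum_of_norm_bounded hsum.hasSum hterm).trans
    ((Real.tsum_le_of_sum_range_le (fun n => by positivity) hpart).trans ?_)
  calc Q * (2 / ((m : ℝ) + 1))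
      = (|A| * C * 2 ^ β) * 2 * ((m : ℝ) + 1) * kernelCoeff μ m / ((m : ℝ) + 1) ^ (β + 2) := by
        rw [hQ, pow_add]; field_simp
    _ ≤ _ := by gcongr; linarith

/-- The kernel is at most of order `(m + 1) b_m` at distance at least `1 / (m + 1)` from `1`. -/
theorem norm_kernelSeries_le (h : IsTailDoubling μ) {c₀ : ℝ} (hc₀ : 0 < c₀) : ∃ C > (0 : ℝ),
    ∀ m : ℕ, ∀ w : ℂ, ‖w‖ < 1 → c₀ ≤ ‖1 - w‖ * ((m : ℝ) + 1) →
      ‖kernelSeries μ w‖ ≤ C * (((m : ℝ) + 1) * kernelCoeff μ m) := by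
  obtain ⟨L, hL, hlow⟩ := h.kernelCoeff_le_of_le
  obtain ⟨T, hT, k, htail⟩ := h.norm_tsum_tail_le
  choose A hA using h.fwdDiff_kernelCoeff_bound
  refine ⟨L + (∑ j ∈ Finset.range k, |A j| / c₀ ^ (j + 1) + T / c₀ ^ k), by positivity,
    fun m w hw hcw => ?_⟩
  have hm := h.kernelCoeff_pos m
  have hM : (0 : ℝ) < (m : ℝ) + 1 := by positivity
  have hd : c₀ / ((m : ℝ) + 1) ≤ ‖1 - w‖ := by rwa [div_le_iff₀ hM]
  have hd0 : 0 < ‖1 - w‖ := (by positivity : 0 < c₀ / ((m : ℝ) + 1)).trans_le hd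
  have hs := h.summable_kernelCoeff_complex hw
  -- The series is cut at `m`. The first `m` terms are each at most of order `b_m`. In the shifted
  -- series `a`, every factor `1/|1-w| ≤ (m+1)/c₀` produced by summation by parts is compensated by
  -- the gain `1/(m+1)` of a difference.
  set a : ℕ → ℝ := fun n => kernelCoeff μ (n + m) with ha
  have haD : ∀ j n, (fwdDiff 1)^[j] a n = (fwdDiff 1)^[j] (kernelCoeff μ) (n + m) :=
    fun j n => fwdDiff_iter_comp_add 1 (kernelCoeff μ) m j n
  have hsa : ∀ j, Summable fun n => (((fwdDiff 1)^[j] a n : ℝ) : ℂ) * w ^ n := by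
    intro j
    refine Summable.of_norm ((h.summable_fwdDiff j m (norm_nonneg w) hw).congr fun n => ?_)
    rw [norm_mul, norm_pow, Complex.norm_real, Real.norm_eq_abs, haD]
  have hsplit : kernelSeries μ w = ∑ n ∈ Finset.range m, (kernelCoeff μ n : ℂ) * w ^ n +
      w ^ m * ∑' n, (a n : ℂ) * w ^ n := by
    unfold kernelSeries
    rw [← hs.sum_add_tsum_nat_add m, ← tsum_mul_left]
    congr 1
    refine tsum_congr fun n => ?_
    rw [pow_add]
    ring
  have h1 : ‖∑ n ∈ Finset.range m, (kernelCoeff μ n : ℂ) * w ^ n‖ ≤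
      L * (((m : ℝ) + 1) * kernelCoeff μ m) := by
    refine (norm_sum_le _ _).trans ?_
    calc ∑ n ∈ Finset.range m, ‖(kernelCoeff μ n : ℂ) * w ^ n‖
        ≤ ∑ n ∈ Finset.range m, L * kernelCoeff μ m := by
          refine Finset.sum_le_sum fun n hn => ?_
          have hb := h.kernelCoeff_pos n
          rw [norm_mul, norm_pow, Complex.norm_real, Real.norm_of_nonneg hb.le]
          refine (mul_le_of_le_one_right hb.le (pow_le_one₀ (norm_nonneg _) hw.le)).trans ?_
          exact hlow m n (Finset.mem_range.1 hn).le
      _ = m * (L * kernelCoeff μ m) := by simp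
      _ ≤ ((m : ℝ) + 1) * (L * kernelCoeff μ m) := by gcongr; linarith
      _ = _ := by ring
  have h2 := norm_tsum_le_fwdDiff hw.le hd0 hsa k
  have h3 : ∀ j, |(fwdDiff 1)^[j] a 0| / ‖1 - w‖ ^ (j + 1) ≤
      |A j| / c₀ ^ (j + 1) * (((m : ℝ) + 1) * kernelCoeff μ m) := by
    intro j
    have := hA j m
    rw [haD, zero_add]
    calc |(fwdDiff 1)^[j] (kernelCoeff μ) m| / ‖1 - w‖ ^ (j + 1)
        ≤ (|A j| * (kernelCoeff μ m / ((m : ℝ) + 1) ^ j)) / (c₀ / ((m : ℝ) + 1)) ^ (j + 1) := by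
          gcongr
          exact this.trans (by gcongr; exact le_abs_self _)
      _ = _ := by rw [div_pow, pow_succ ((m : ℝ) + 1)]; field_simp
  have h4 : ‖∑' n, (((fwdDiff 1)^[k] a n : ℝ) : ℂ) * w ^ n‖ / ‖1 - w‖ ^ k ≤
      T / c₀ ^ k * (((m : ℝ) + 1) * kernelCoeff μ m) := by
    simp_rw [haD]
    calc _ ≤ (T * ((m : ℝ) + 1) * kernelCoeff μ m / ((m : ℝ) + 1) ^ k) /
          (c₀ / ((m : ℝ) + 1)) ^ k := by
          gcongr
          exact htail m w hw
      _ = _ := by rw [div_pow]; field_simp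
  have h5 : ‖w ^ m * ∑' n, (a n : ℂ) * w ^ n‖ ≤ ‖∑' n, (a n : ℂ) * w ^ n‖ := by
    rw [norm_mul, norm_pow]
    exact mul_le_of_le_one_left (norm_nonneg _) (pow_le_one₀ (norm_nonneg _) hw.le)
  calc ‖kernelSeries μ w‖ ≤ ‖∑ n ∈ Finset.range m, (kernelCoeff μ n : ℂ) * w ^ n‖ +
        ‖w ^ m * ∑' n, (a n : ℂ) * w ^ n‖ := by rw [hsplit]; exact norm_add_le _ _
    _ ≤ L * (((m : ℝ) + 1) * kernelCoeff μ m) +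
        (∑ j ∈ Finset.range k, |A j| / c₀ ^ (j + 1) * (((m : ℝ) + 1) * kernelCoeff μ m) +
          T / c₀ ^ k * (((m : ℝ) + 1) * kernelCoeff μ m)) := by
        refine add_le_add h1 (h5.trans (h2.trans (add_le_add ?_ h4)))
        exact Finset.sum_le_sum fun j _ => h3 j
    _ = _ := by rw [← Finset.sum_mul]; ring

/-- The kernel at distance comparable to `v` from `1`. -/
theorem norm_kernelSeries_le_tail (h : IsTailDoubling μ) {c₀ : ℝ} (hc₀ : 0 < c₀) :
    ∃ C > (0 : ℝ), ∀ v ∈ Ioc (0 : ℝ) 1, ∀ w : ℂ, ‖w‖ < 1 → c₀ * v ≤ ‖1 - w‖ →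
      ‖kernelSeries μ w‖ ≤ C / (v * μ.real (Ioi (1 - v))) := by
  have := h.isFinite
  -- The index used below has `m + 1` equal to the integer part of `1/v`, so only `(m+1)v ≥ 1/2` is
  -- available; hence `c₀/2`.
  obtain ⟨A, hA, h1⟩ := h.norm_kernelSeries_le (half_pos hc₀)
  obtain ⟨B, hB, h2⟩ := h.kernelCoeff_le
  refine ⟨A * B, by positivity, fun v hv w hw hvw => ?_⟩
  have hv0 := hv.1
  have hmem : 1 - v ∈ Ico (0 : ℝ) 1 := ⟨by linarith [hv.2], by linarith⟩
  obtain ⟨m, hm1, hm2⟩ := exists_one_sub_inv_near hmem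
  rw [sub_sub_cancel] at hm1 hm2
  have hM : (0 : ℝ) < (m : ℝ) + 1 := by positivity
  have h3 := h1 m w hw (by
    have : c₀ * v * ((m : ℝ) + 1) ≤ ‖1 - w‖ * ((m : ℝ) + 1) := by gcongr
    nlinarith [mul_lt_mul_of_pos_left hm2 hc₀,
      mul_nonneg (mul_pos hc₀ hv0).le (m.cast_nonneg (α := ℝ))])
  have hτ := h.tail_pos _ hmem
  have hτ' : μ.real (Ioi (1 - v)) ≤ μ.real (Ioi (1 - 1 / ((m : ℝ) + 1))) := by
    refine tail_antitone μ ?_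
    have : v ≤ 1 / ((m : ℝ) + 1) := by rw [le_div_iff₀ hM]; linarith
    linarith
  calc ‖kernelSeries μ w‖ ≤ A * (((m : ℝ) + 1) * kernelCoeff μ m) := h3
    _ ≤ A * (1 / v * (B / μ.real (Ioi (1 - v)))) := by
        have hb := h.kernelCoeff_pos m
        gcongr
        · rw [le_div_iff₀ hv0]; exact hm1
        · exact (h2 m).trans (by gcongr)
    _ = _ := by field_simp

end IsTailDoubling

/-! ### Distance from `1` to the points of a circle centred at `0` -/

theorem norm_one_sub_circleMap_le {ρ : ℝ} (hρ : ρ ∈ Icc (0 : ℝ) 1) (θ : ℝ) :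
    ‖1 - circleMap 0 ρ θ‖ ≤ 1 - ρ + |θ| := by
  have h1 : ‖Complex.exp (Complex.I * θ) - 1‖ ≤ |θ| := Real.norm_exp_I_mul_ofReal_sub_one_le
  have h2 : 1 - circleMap 0 ρ θ = ((1 - ρ : ℝ) : ℂ) - ρ * (Complex.exp (Complex.I * θ) - 1) := by
    rw [circleMap_zero, mul_comm Complex.I]; push_cast; ring
  rw [h2]
  refine (norm_sub_le _ _).trans ?_
  rw [Complex.norm_real, norm_mul, Complex.norm_real, Real.norm_of_nonneg hρ.1,
    Real.norm_of_nonneg (by linarith [hρ.2])]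
  have := mul_le_of_le_one_left (norm_nonneg (Complex.exp (Complex.I * θ) - 1)) hρ.2
  linarith

theorem one_sub_le_norm_one_sub_circleMap {ρ : ℝ} (hρ : 0 ≤ ρ) (θ : ℝ) :
    1 - ρ ≤ ‖1 - circleMap 0 ρ θ‖ := by
  have := norm_sub_norm_le 1 (circleMap 0 ρ θ)
  rwa [norm_one, norm_circleMap_zero, abs_of_nonneg hρ] at this

/-- By Jordan's inequality `|θ|/2 ≤ |e^(iθ) - 1| ≤ |1-w| + (1-ρ) ≤ 2|1-w|`. Averaging `|θ|/4 ≤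
|1-w|` with `1-ρ ≤ |1-w|` gives more than the constant `1/8`. -/
theorem le_norm_one_sub_circleMap {ρ : ℝ} (hρ : ρ ∈ Icc (0 : ℝ) 1) {θ : ℝ} (hθ : |θ| ≤ Real.pi) :
    1 / 8 * (1 - ρ + |θ|) ≤ ‖1 - circleMap 0 ρ θ‖ := by
  have h1 := one_sub_le_norm_one_sub_circleMap hρ.1 θ
  have h2 : 2 / Real.pi * |θ| ≤ ‖Complex.exp (Complex.I * θ) - 1‖ := by
    rw [Complex.norm_exp_I_mul_ofReal_sub_one, norm_mul, Real.norm_eq_abs, Real.norm_eq_abs,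
      abs_of_pos (two_pos : (0 : ℝ) < 2)]
    have := Real.mul_abs_le_abs_sin (x := θ / 2) (by
      rw [abs_div, abs_of_pos (two_pos : (0 : ℝ) < 2)]; linarith)
    rw [abs_div, abs_of_pos (two_pos : (0 : ℝ) < 2)] at this
    linarith
  have h3 : ‖Complex.exp (Complex.I * θ) - 1‖ ≤ ‖1 - circleMap 0 ρ θ‖ + (1 - ρ) := by
    have e : Complex.exp (Complex.I * θ) - 1 =
        -(1 - circleMap 0 ρ θ) + ((1 - ρ : ℝ) : ℂ) * Complex.exp (θ * Complex.I) := by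
      rw [circleMap_zero, mul_comm Complex.I]; push_cast; ring
    rw [e]
    refine (norm_add_le _ _).trans ?_
    rw [norm_neg, norm_mul, Complex.norm_exp_ofReal_mul_I, Complex.norm_real,
      Real.norm_of_nonneg (by linarith [hρ.2]), mul_one]
  have h4 : 1 / 2 * |θ| ≤ 2 / Real.pi * |θ| := by
    refine mul_le_mul_of_nonneg_right ?_ (abs_nonneg _)
    rw [div_le_div_iff₀ two_pos Real.pi_pos]
    linarith [Real.pi_le_four]
  linarith [abs_nonneg θ]

theorem norm_circleMap_sub_le {ρ : ℝ} (hρ : 0 ≤ ρ) (θ : ℝ) (n : ℕ) :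
    ‖(circleMap 0 ρ θ) ^ n - (ρ : ℂ) ^ n‖ ≤ |θ| * (n * ρ ^ n) := by
  have h1 : ‖Complex.exp (Complex.I * ((n * θ : ℝ) : ℂ)) - 1‖ ≤ |n * θ| :=
    Real.norm_exp_I_mul_ofReal_sub_one_le
  have h2 : (circleMap 0 ρ θ) ^ n - (ρ : ℂ) ^ n =
      (ρ : ℂ) ^ n * (Complex.exp (Complex.I * ((n * θ : ℝ) : ℂ)) - 1) := by
    rw [circleMap_zero, mul_pow, ← Complex.exp_nat_mul, mul_sub, mul_one]
    congr 3
    push_cast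
    ring
  rw [h2, norm_mul, norm_pow, Complex.norm_real, Real.norm_of_nonneg hρ]
  rw [abs_mul, Nat.abs_cast] at h1
  calc ρ ^ n * _ ≤ ρ ^ n * (n * |θ|) := by gcongr
    _ = _ := by ring

/-- The order of magnitude of the `p`-th power of the regularized kernel near `t`. -/
noncomputable def kernelDensity (μ : Measure ℝ) (p : ℝ) (N : ℕ) (t : ℝ) : ℝ :=
  (μ.real (Ioi t) ^ p * (1 - t) ^ (p * (1 - (N : ℝ))))⁻¹

theorem measurable_kernelDensity (μ : Measure ℝ) [IsFiniteMeasure μ] (p : ℝ) (N : ℕ) :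
    Measurable (kernelDensity μ p N) := by
  have : Measurable fun t => μ.real (Ioi t) := (tail_antitone μ).measurable
  unfold kernelDensity
  fun_prop

namespace IsTailDoubling

variable {μ : Measure ℝ}

/-- The form in which the density compares with `|1-w|^N |K(w)|`: one of the `N` factors cancels the
`v` in the bound `1/(v τ(1-v))`. -/
theorem kernelDensity_eq (h : IsTailDoubling μ) (p : ℝ) {N : ℕ} (hN : 1 ≤ N) {t : ℝ}
    (ht : t ∈ Ico (0 : ℝ) 1) :
    kernelDensity μ p N t = ((1 - t) ^ (N - 1) / μ.real (Ioi t)) ^ p := by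
  have h1 : 0 < 1 - t := by linarith [ht.2]
  have hτ := h.tail_pos t ht
  unfold kernelDensity
  rw [Real.div_rpow (by positivity) hτ.le, mul_inv, ← Real.rpow_neg h1.le, ← Real.rpow_natCast,
    ← Real.rpow_mul h1.le, Nat.cast_sub hN, div_eq_inv_mul]
  congr 2
  push_cast
  ring

theorem kernelDensity_nonneg (h : IsTailDoubling μ) (p : ℝ) (N : ℕ) {t : ℝ}
    (ht : t ∈ Ico (0 : ℝ) 1) : 0 ≤ kernelDensity μ p N t := by
  have h1 : 0 < 1 - t := by linarith [ht.2]
  have hτ := h.tail_pos t ht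
  unfold kernelDensity
  positivity

/-- Upper pointwise estimate of the regularized kernel on circles. -/
theorem regularized_kernel_le (h : IsTailDoubling μ) {p : ℝ} (hp : 0 ≤ p) {N : ℕ} (hN : 1 ≤ N) :
    ∃ C > (0 : ℝ), ∀ ρ ∈ Ico (0 : ℝ) 1, ∀ θ : ℝ, |θ| ≤ Real.pi →
      (|θ| < ρ → ‖(1 - circleMap 0 ρ θ) ^ N * kernelSeries μ (circleMap 0 ρ θ)‖ ^ p ≤
        C * kernelDensity μ p N (ρ - |θ|)) ∧
      (ρ ≤ |θ| → ‖(1 - circleMap 0 ρ θ) ^ N * kernelSeries μ (circleMap 0 ρ θ)‖ ^ p ≤ C) := by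
  obtain ⟨A, hA, hle⟩ := h.norm_kernelSeries_le_tail (c₀ := 1 / 8) (by norm_num)
  have hτ0 := h.tail_pos 0 ⟨le_rfl, one_pos⟩
  refine ⟨max (A ^ p) ((2 ^ N * (A / μ.real (Ioi 0))) ^ p), by positivity,
    fun ρ hρ θ hθ => ⟨fun hθρ => ?_, fun hθρ => ?_⟩⟩
  all_goals
    have hρ' : ρ ∈ Icc (0 : ℝ) 1 := ⟨hρ.1, hρ.2.le⟩
    have hw : ‖circleMap 0 ρ θ‖ < 1 := by
      rw [norm_circleMap_zero, abs_of_nonneg hρ.1]; exact hρ.2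
    have hlow := le_norm_one_sub_circleMap hρ' hθ
    have hup := norm_one_sub_circleMap_le hρ' θ
    have habs := abs_nonneg θ
    rw [norm_mul, norm_pow]
  -- For `|θ| < ρ` one has `v < 1`, so `1 - v = ρ - |θ|` is an admissible tail point and `|1-w| ≥
  -- v/8`.
  · set v := 1 - ρ + |θ| with hv
    have hv0 : 0 < v := by linarith [hρ.2]
    have e : ρ - |θ| = 1 - v := by rw [hv]; ring
    have hmem : 1 - v ∈ Ico (0 : ℝ) 1 := ⟨by linarith, by linarith⟩
    have hτ := h.tail_pos _ hmem
    have h1 := hle v ⟨hv0, by linarith⟩ _ hw hlow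
    rw [e, h.kernelDensity_eq p hN hmem, sub_sub_cancel]
    calc _ ≤ (v ^ N * (A / (v * μ.real (Ioi (1 - v))))) ^ p := by gcongr
      _ = (A * (v ^ (N - 1) / μ.real (Ioi (1 - v)))) ^ p := by
          congr 1
          obtain ⟨k, rfl⟩ : ∃ k, N = k + 1 := ⟨N - 1, by omega⟩
          rw [Nat.add_sub_cancel, pow_succ]
          field_simp
      _ = A ^ p * (v ^ (N - 1) / μ.real (Ioi (1 - v))) ^ p :=
          Real.mul_rpow hA.le (by positivity)
      _ ≤ _ := by gcongr; exact le_max_left _ _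
  -- For `ρ ≤ |θ|` the point stays at distance at least `1/8` from `1`, so `v = 1` gives a uniform
  -- bound.
  · have h1 := hle 1 ⟨one_pos, le_rfl⟩ _ hw (by linarith)
    rw [one_mul, sub_self] at h1
    have h2 : ‖1 - circleMap 0 ρ θ‖ ≤ 2 := by
      refine (norm_sub_le _ _).trans ?_
      rw [norm_one]; linarith
    refine le_trans ?_ (le_max_right _ _)
    gcongr

/-- All terms are positive, so only those with index at least `m` are kept, `m + 1` being the
integer part of `1/(1-ρ)`. There the coefficients are at least `b_m / L`, `ρ^m ≥ 1/e`, and the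
geometric series supplies `1/(1-ρ)`. -/
theorem le_tsum_kernelCoeff (h : IsTailDoubling μ) : ∃ c > (0 : ℝ), ∀ ρ ∈ Ico (0 : ℝ) 1,
    c / ((1 - ρ) * μ.real (Ioi ρ)) ≤ ∑' n, kernelCoeff μ n * ρ ^ n := by
  obtain ⟨L, hL, hlow⟩ := h.kernelCoeff_le_of_le
  obtain ⟨B, hB, hle⟩ := h.le_kernelCoeff
  obtain ⟨C, hC, β, htail⟩ := h.tail_le
  refine ⟨Real.exp (-1) / (L * B * (C * 3 ^ β)), by positivity, fun ρ hρ => ?_⟩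
  obtain ⟨m, hm1, hm2⟩ := exists_one_sub_inv_near hρ
  have hd : 0 < 1 - ρ := by linarith [hρ.2]
  have hM : (0 : ℝ) < (m : ℝ) + 1 := by positivity
  have hτ := h.tail_pos ρ hρ
  have hτm := h.tail_pos _ (one_sub_inv_mem_Ico m)
  have hb := h.kernelCoeff_pos m
  have hs := h.summable_kernelCoeff hρ.1 hρ.2
  have h1 : ∑' n, kernelCoeff μ (n + m) * ρ ^ (n + m) ≤ ∑' n, kernelCoeff μ n * ρ ^ n := by
    rw [← hs.sum_add_tsum_nat_add m]
    exact le_add_of_nonneg_left (Finset.sum_nonneg fun n _ =>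
      mul_nonneg (h.kernelCoeff_pos n).le (pow_nonneg hρ.1 n))
  have h2 : kernelCoeff μ m / L * ρ ^ m * (1 - ρ)⁻¹ ≤
      ∑' n, kernelCoeff μ (n + m) * ρ ^ (n + m) := by
    rw [← tsum_geometric_of_lt_one hρ.1 hρ.2, ← tsum_mul_left]
    refine Summable.tsum_le_tsum (fun n => ?_)
      ((summable_geometric_of_lt_one hρ.1 hρ.2).mul_left _) ((summable_nat_add_iff m).2 hs)
    have h3 : kernelCoeff μ m / L ≤ kernelCoeff μ (n + m) := by
      rw [div_le_iff₀ hL, mul_comm]; exact hlow (n + m) m (by omega)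
    calc kernelCoeff μ m / L * ρ ^ m * ρ ^ n = kernelCoeff μ m / L * ρ ^ (n + m) := by
          rw [pow_add]; ring
      _ ≤ _ := mul_le_mul_of_nonneg_right h3 (pow_nonneg hρ.1 _)
  have h4 : Real.exp (-1) ≤ ρ ^ m := by
    refine (exp_neg_one_le_pow m).trans (pow_le_pow_left₀ (one_sub_inv_mem_Ico m).1 ?_ m)
    have : 1 - ρ ≤ 1 / ((m : ℝ) + 1) := by rw [le_div_iff₀ hM]; linarith
    linarith
  have h5 : 1 / μ.real (Ioi ρ) ≤ C * 3 ^ β * (1 / μ.real (Ioi (1 - 1 / ((m : ℝ) + 1)))) := by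
    have h6 := htail _ (one_sub_inv_mem_Ico m) ρ hρ
    have h7 : (1 - (1 - 1 / ((m : ℝ) + 1))) / (1 - ρ) ≤ 2 := by
      rw [sub_sub_cancel, div_le_iff₀ hd, div_le_iff₀ hM]
      nlinarith [mul_nonneg (m.cast_nonneg (α := ℝ)) hd.le]
    rw [mul_one_div, div_le_div_iff₀ hτ hτm, one_mul]
    refine h6.trans ?_
    have : 0 ≤ (1 - (1 - 1 / ((m : ℝ) + 1))) / (1 - ρ) := by
      rw [sub_sub_cancel]; positivity
    gcongr
    linarith
  have h8 : 1 / μ.real (Ioi ρ) ≤ C * 3 ^ β * (B * kernelCoeff μ m) :=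
    h5.trans (by gcongr; exact hle m)
  refine le_trans ?_ (h2.trans h1)
  calc _ = Real.exp (-1) * (1 / μ.real (Ioi ρ)) * (1 - ρ)⁻¹ / (L * B * (C * 3 ^ β)) := by
        field_simp
    _ ≤ ρ ^ m * (C * 3 ^ β * (B * kernelCoeff μ m)) * (1 - ρ)⁻¹ / (L * B * (C * 3 ^ β)) := by
        gcongr
        exact pow_nonneg hρ.1 m
    _ = _ := by field_simp

/-- The kernel is large near the positive radius. -/
theorem le_norm_kernelSeries (h : IsTailDoubling μ) : ∃ c > (0 : ℝ), ∃ ε > (0 : ℝ),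
    ∀ ρ ∈ Ico (0 : ℝ) 1, ∀ θ : ℝ, |θ| ≤ ε * (1 - ρ) →
      c / ((1 - ρ) * μ.real (Ioi ρ)) ≤ ‖kernelSeries μ (circleMap 0 ρ θ)‖ := by
  obtain ⟨c, hc, hlow⟩ := h.le_tsum_kernelCoeff
  obtain ⟨A, hA, hle⟩ := h.norm_kernelSeries_le_tail one_pos
  obtain ⟨C, hC, β, htail⟩ := h.tail_le
  -- `E` collects the constants in the bound for the variation of `K` along the arc; `ε = (c/2)/E`
  -- makes that variation at most half of the lower bound `c/((1-ρ)τ(ρ))` at `θ = 0`.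
  set E : ℝ := 2 * Real.exp 1 * (2 * A * (C * 3 ^ β)) with hE
  have hE0 : 0 < E := by positivity
  refine ⟨c / 2, by positivity, c / 2 / E, by positivity, fun ρ hρ θ hθ => ?_⟩
  have hd : 0 < 1 - ρ := by linarith [hρ.2]
  have hτ := h.tail_pos ρ hρ
  -- With `ρ = s^2`, one factor `s^n` absorbs `n` at the price `2e/(1-ρ)`, and the other leaves the
  -- series at the radius `s`. Since `1-s` and `1-ρ` are comparable, the upper estimate of `K` at
  -- `s` bounds it at the scale of `ρ`.
  set s := Real.sqrt ρ with hs
  have hs0 : 0 ≤ s := Real.sqrt_nonneg ρ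
  have hs2 : s ^ 2 = ρ := Real.sq_sqrt hρ.1
  have hs1 : s < 1 := by nlinarith [hρ.2]
  have hds : (1 - ρ) / 2 ≤ 1 - s := by nlinarith
  have hds0 : 0 < 1 - s := by linarith
  have hτs := h.tail_pos s ⟨hs0, hs1⟩
  have hsum := h.summable_kernelCoeff hs0 hs1
  have hsρ := h.summable_kernelCoeff hρ.1 hρ.2
  have hw : ‖circleMap 0 ρ θ‖ < 1 := by
    rw [norm_circleMap_zero, abs_of_nonneg hρ.1]; exact hρ.2
  have hpow : ∀ n : ℕ, n * ρ ^ n ≤ 2 * Real.exp 1 / (1 - ρ) * s ^ n := by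
    intro n
    have h1 := pow_mul_pow_le_factorial hs0 hs1.le n 1
    simp only [pow_one, Nat.factorial_one, Nat.cast_one, one_mul] at h1
    have h2 : n * s ^ n ≤ 2 * Real.exp 1 / (1 - ρ) := by
      rw [le_div_iff₀ hd]
      have : 0 ≤ s ^ n := pow_nonneg hs0 n
      have h3 : n * s ^ n * (1 - ρ) ≤ n * s ^ n * (2 * (1 - s)) := by gcongr; linarith
      nlinarith [mul_nonneg this hds0.le]
    calc n * ρ ^ n = (n * s ^ n) * s ^ n := by rw [← hs2, ← pow_mul, mul_comm 2 n, pow_mul]; ring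
      _ ≤ _ := by gcongr
  have hS : ∑' n, kernelCoeff μ n * s ^ n ≤ 2 * A * (C * 3 ^ β) / ((1 - ρ) * μ.real (Ioi ρ)) := by
    have hcast : kernelSeries μ (s : ℂ) = ((∑' n, kernelCoeff μ n * s ^ n : ℝ) : ℂ) := by
      unfold kernelSeries
      push_cast
      rfl
    have hns : ‖(1 : ℂ) - s‖ = 1 - s := by
      rw [← Complex.ofReal_one, ← Complex.ofReal_sub, Complex.norm_real,
        Real.norm_of_nonneg hds0.le]
    have h1 := hle (1 - s) ⟨hds0, by linarith⟩ (s : ℂ)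
      (by rwa [Complex.norm_real, Real.norm_of_nonneg hs0]) (by rw [one_mul, hns])
    rw [hcast, Complex.norm_real, sub_sub_cancel] at h1
    have h2 : μ.real (Ioi ρ) ≤ C * 3 ^ β * μ.real (Ioi s) := by
      refine (htail ρ hρ s ⟨hs0, hs1⟩).trans ?_
      have h3 : (1 - ρ) / (1 - s) ≤ 2 := by rw [div_le_iff₀ hds0]; linarith
      gcongr
      linarith
    refine (Real.le_norm_self _).trans (h1.trans ?_)
    rw [div_le_div_iff₀ (by positivity) (by positivity)]
    calc A * ((1 - ρ) * μ.real (Ioi ρ))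
        ≤ A * ((2 * (1 - s)) * (C * 3 ^ β * μ.real (Ioi s))) := by gcongr; linarith
      _ = _ := by ring
  have hdiff : ‖kernelSeries μ (circleMap 0 ρ θ) - ((∑' n, kernelCoeff μ n * ρ ^ n : ℝ) : ℂ)‖ ≤
      |θ| * (2 * Real.exp 1 / (1 - ρ) * ∑' n, kernelCoeff μ n * s ^ n) := by
    have hsC : Summable fun n : ℕ => (kernelCoeff μ n : ℂ) * (ρ : ℂ) ^ n := by
      refine (Complex.summable_ofReal.2 hsρ).congr fun n => ?_
      push_cast
      rfl
    unfold kernelSeries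
    push_cast
    rw [← (h.summable_kernelCoeff_complex hw).tsum_sub hsC, ← tsum_mul_left, ← tsum_mul_left]
    refine tsum_of_norm_bounded ((hsum.mul_left _).mul_left _).hasSum fun n => ?_
    have hb := h.kernelCoeff_pos n
    rw [← mul_sub, norm_mul, Complex.norm_real, Real.norm_of_nonneg hb.le]
    calc kernelCoeff μ n * ‖circleMap 0 ρ θ ^ n - (ρ : ℂ) ^ n‖
        ≤ kernelCoeff μ n * (|θ| * (2 * Real.exp 1 / (1 - ρ) * s ^ n)) := by
          gcongr
          exact (norm_circleMap_sub_le hρ.1 θ n).trans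
            (mul_le_mul_of_nonneg_left (hpow n) (abs_nonneg θ))
      _ = _ := by ring
  set Q := (1 - ρ) * μ.real (Ioi ρ) with hQ
  have hQ0 : 0 < Q := by positivity
  have hbound : |θ| * (2 * Real.exp 1 / (1 - ρ) * ∑' n, kernelCoeff μ n * s ^ n) ≤ c / 2 / Q := by
    calc _ ≤ (c / 2 / E * (1 - ρ)) * (2 * Real.exp 1 / (1 - ρ) * (2 * A * (C * 3 ^ β) / Q)) := by
          have : 0 ≤ ∑' n, kernelCoeff μ n * s ^ n :=
            tsum_nonneg fun n => mul_nonneg (h.kernelCoeff_pos n).le (pow_nonneg hs0 n)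
          gcongr
      _ = c / 2 / Q := by rw [hE]; field_simp
  have h1 := hlow ρ hρ
  have h2 : ∑' n, kernelCoeff μ n * ρ ^ n - ‖kernelSeries μ (circleMap 0 ρ θ)‖ ≤
      ‖kernelSeries μ (circleMap 0 ρ θ) - ((∑' n, kernelCoeff μ n * ρ ^ n : ℝ) : ℂ)‖ := by
    rw [norm_sub_rev]
    refine le_trans ?_ (norm_sub_norm_le _ _)
    rw [Complex.norm_real]
    linarith [Real.le_norm_self (∑' n, kernelCoeff μ n * ρ ^ n)]
  have h3 : c / Q = c / 2 / Q + c / 2 / Q := by ring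
  linarith

/-- Lower pointwise estimate of the regularized kernel near the positive radius. -/
theorem le_regularized_kernel (h : IsTailDoubling μ) {p : ℝ} (hp : 0 ≤ p) {N : ℕ} (hN : 1 ≤ N) :
    ∃ c > (0 : ℝ), ∃ ε > (0 : ℝ), ∀ ρ ∈ Ico (0 : ℝ) 1, ∀ θ : ℝ, |θ| ≤ ε * (1 - ρ) →
      c * kernelDensity μ p N ρ ≤
        ‖(1 - circleMap 0 ρ θ) ^ N * kernelSeries μ (circleMap 0 ρ θ)‖ ^ p := by
  obtain ⟨c, hc, ε, hε, hle⟩ := h.le_norm_kernelSeries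
  refine ⟨c ^ p, by positivity, ε, hε, fun ρ hρ θ hθ => ?_⟩
  have hd : 0 < 1 - ρ := by linarith [hρ.2]
  have hτ := h.tail_pos ρ hρ
  rw [h.kernelDensity_eq p hN hρ, ← Real.mul_rpow hc.le (by positivity), norm_mul, norm_pow]
  refine Real.rpow_le_rpow (by positivity) ?_ hp
  calc c * ((1 - ρ) ^ (N - 1) / μ.real (Ioi ρ))
      = (1 - ρ) ^ N * (c / ((1 - ρ) * μ.real (Ioi ρ))) := by
        obtain ⟨k, rfl⟩ : ∃ k, N = k + 1 := ⟨N - 1, by omega⟩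
        rw [Nat.add_sub_cancel, pow_succ]
        field_simp
    _ ≤ _ := by
        gcongr
        · exact one_sub_le_norm_one_sub_circleMap hρ.1 θ
        · exact hle ρ hρ θ hθ

end IsTailDoubling

/-! ### Integral estimates -/

/-- Tonelli on `{0 < t < r}`; this is how the tail of `ν` appears in the upper estimate. -/
theorem lintegral_lintegral_Ioo (ν : Measure ℝ) [SFinite ν] {φ : ℝ → ENNReal}
    (hφ : Measurable φ) :
    ∫⁻ r, (∫⁻ t in Ioo 0 r, φ t) ∂ν = ∫⁻ t in Ioi 0, φ t * ν (Ioi t) := by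
  have h1 : ∀ r : ℝ, ∫⁻ t in Ioo 0 r, φ t =
      ∫⁻ t in Ioi 0, {q : ℝ × ℝ | q.2 < q.1}.indicator (fun q => φ q.2) (r, t) := by
    intro r
    rw [← Ioi_inter_Iio, inter_comm, ← Measure.restrict_restrict measurableSet_Iio,
      ← lintegral_indicator measurableSet_Iio]
    rfl
  have hmeas : Measurable ({q : ℝ × ℝ | q.2 < q.1}.indicator fun q => φ q.2) :=
    (hφ.comp measurable_snd).indicator (measurableSet_lt measurable_snd measurable_fst)
  simp_rw [h1]
  rw [lintegral_lintegral_swap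
    (f := fun r t => {q : ℝ × ℝ | q.2 < q.1}.indicator (fun q => φ q.2) (r, t)) hmeas.aemeasurable]
  refine lintegral_congr fun t => ?_
  have h2 : ∀ r : ℝ, {q : ℝ × ℝ | q.2 < q.1}.indicator (fun q => φ q.2) (r, t) =
      (Ioi t).indicator (fun _ => φ t) r := fun r => rfl
  simp_rw [h2]
  rw [lintegral_indicator measurableSet_Ioi, setLIntegral_const]

/-- The mean of the `p`-th power of the regularized kernel over the circle of radius `ρ`. -/
noncomputable def kernelMean (μ : Measure ℝ) (p : ℝ) (N : ℕ) (ρ : ℝ) : ENNReal :=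
  ∫⁻ θ in Ioo (-Real.pi) Real.pi,
    ENNReal.ofReal (‖(1 - circleMap 0 ρ θ) ^ N * kernelSeries μ (circleMap 0 ρ θ)‖ ^ p)

namespace IsTailDoubling

variable {μ : Measure ℝ}

/-- The bound `H(ρ-|θ|)` is a translate or reflected translate of `H` in `θ`, so its integral over
the circle is at most twice the integral of `H` over `(0,ρ]`. The angles with `|θ| ≥ ρ` contribute a
constant. -/
theorem kernelMean_le (h : IsTailDoubling μ) {p : ℝ} (hp : 0 ≤ p) {N : ℕ} (hN : 1 ≤ N) :
    ∃ C > (0 : ℝ), ∀ ρ ∈ Ico (0 : ℝ) 1, kernelMean μ p N ρ ≤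
      ENNReal.ofReal C * (1 + ∫⁻ t in Ioc 0 ρ, ENNReal.ofReal (kernelDensity μ p N t)) := by
  have := h.isFinite
  obtain ⟨C, hC, hle⟩ := h.regularized_kernel_le hp hN
  have hpi := Real.pi_pos
  refine ⟨C * (2 * Real.pi + 2), by positivity, fun ρ hρ => ?_⟩
  -- `H` is cut off outside `(0,ρ]`, so that the `θ`-integral may be enlarged to the whole line,
  -- where translation invariance applies.
  set k : ℝ → ENNReal :=
    (Ioc 0 ρ).indicator fun t => ENNReal.ofReal (kernelDensity μ p N t) with hk
  have hkm : Measurable k :=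
    ((measurable_kernelDensity μ p N).ennreal_ofReal).indicator measurableSet_Ioc
  have hpt : ∀ θ ∈ Ioo (-Real.pi) Real.pi,
      ENNReal.ofReal (‖(1 - circleMap 0 ρ θ) ^ N * kernelSeries μ (circleMap 0 ρ θ)‖ ^ p) ≤
        ENNReal.ofReal C * (1 + (k (ρ - θ) + k (ρ + θ))) := by
    intro θ hθ
    have hθ' : |θ| ≤ Real.pi := abs_le.2 ⟨hθ.1.le, hθ.2.le⟩
    obtain ⟨h1, h2⟩ := hle ρ hρ θ hθ'
    rcases lt_or_ge |θ| ρ with hlt | hge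
    · have hmem : ρ - |θ| ∈ Ioc 0 ρ := ⟨by linarith, by linarith [abs_nonneg θ]⟩
      have h3 : ENNReal.ofReal (kernelDensity μ p N (ρ - |θ|)) ≤ k (ρ - θ) + k (ρ + θ) := by
        rcases abs_cases θ with ⟨e, _⟩ | ⟨e, _⟩ <;> rw [e] at hmem ⊢
        · refine le_trans ?_ le_self_add
          rw [hk, indicator_of_mem hmem]
        · rw [sub_neg_eq_add] at hmem ⊢
          refine le_trans ?_ le_add_self
          rw [hk, indicator_of_mem hmem]
      calc _ ≤ ENNReal.ofReal (C * kernelDensity μ p N (ρ - |θ|)) :=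
            ENNReal.ofReal_le_ofReal (h1 hlt)
        _ = ENNReal.ofReal C * ENNReal.ofReal (kernelDensity μ p N (ρ - |θ|)) :=
            ENNReal.ofReal_mul hC.le
        _ ≤ _ := by gcongr; exact h3.trans le_add_self
    · calc _ ≤ ENNReal.ofReal C := ENNReal.ofReal_le_ofReal (h2 hge)
        _ = ENNReal.ofReal C * 1 := (mul_one _).symm
        _ ≤ _ := by gcongr; exact le_self_add
  have hK : ∫⁻ t, k t = ∫⁻ t in Ioc 0 ρ, ENNReal.ofReal (kernelDensity μ p N t) :=
    lintegral_indicator measurableSet_Ioc _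
  calc kernelMean μ p N ρ
      ≤ ∫⁻ θ in Ioo (-Real.pi) Real.pi,
          ENNReal.ofReal C * (1 + (k (ρ - θ) + k (ρ + θ))) :=
        setLIntegral_mono' measurableSet_Ioo hpt
    _ = ENNReal.ofReal C * (ENNReal.ofReal (2 * Real.pi) +
          ((∫⁻ θ in Ioo (-Real.pi) Real.pi, k (ρ - θ)) +
            ∫⁻ θ in Ioo (-Real.pi) Real.pi, k (ρ + θ))) := by
        rw [lintegral_const_mul' _ _ ENNReal.ofReal_ne_top, lintegral_add_left measurable_const,
          lintegral_add_left (f := fun θ => k (ρ - θ)) (hkm.comp (by fun_prop : Measurable fun θ : ℝ => ρ - θ))]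
        simp only [lintegral_const, one_mul, Measure.restrict_apply_univ, Real.volume_Ioo]
        congr 3
        ring
    _ ≤ ENNReal.ofReal C * (ENNReal.ofReal (2 * Real.pi) + ((∫⁻ t, k t) + ∫⁻ t, k t)) := by
        have h1 := (setLIntegral_le_lintegral (Ioo (-Real.pi) Real.pi)
          fun θ => k (ρ - θ)).trans_eq (lintegral_sub_left_eq_self (μ := volume) k ρ)
        have h2 := (setLIntegral_le_lintegral (Ioo (-Real.pi) Real.pi)
          fun θ => k (ρ + θ)).trans_eq (lintegral_add_left_eq_self (μ := volume) k ρ)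
        exact mul_le_mul' le_rfl (add_le_add le_rfl (add_le_add h1 h2))
    _ = ENNReal.ofReal C * (ENNReal.ofReal (2 * Real.pi) * 1 + 2 * ∫⁻ t, k t) := by
        rw [two_mul (∫⁻ t, k t), mul_one]
    _ ≤ ENNReal.ofReal C * (ENNReal.ofReal (2 * Real.pi + 2) * 1 +
          ENNReal.ofReal (2 * Real.pi + 2) * ∫⁻ t, k t) := by
        gcongr
        · linarith
        · rw [← ENNReal.ofReal_ofNat]
          exact ENNReal.ofReal_le_ofReal (by linarith)
    _ = _ := by rw [← mul_add, ← mul_assoc, ← ENNReal.ofReal_mul hC.le, hK]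

/-- The upper estimate, in terms of the measures induced by the weights. -/
theorem lintegral_kernelMean_le (h : IsTailDoubling μ) {ν : Measure ℝ} [IsFiniteMeasure ν]
    (hν : ∀ᵐ r ∂ν, r ∈ Ioo (0 : ℝ) 1) {p : ℝ} (hp : 0 ≤ p) {N : ℕ} (hN : 1 ≤ N) :
    ∃ C > (0 : ℝ), ∀ x ∈ Ico (0 : ℝ) 1,
      ∫⁻ r, ENNReal.ofReal r * kernelMean μ p N (x * r) ∂ν ≤
        ENNReal.ofReal C *
          ((∫⁻ t in Ioc 0 x, ENNReal.ofReal (kernelDensity μ p N t) * ν (Ioi t)) + 1) := by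
  have := h.isFinite
  obtain ⟨C, hC, hle⟩ := h.kernelMean_le hp hN
  refine ⟨C * (ν.real univ + 1), by positivity, fun x hx => ?_⟩
  set φ : ℝ → ENNReal :=
    (Ioc 0 x).indicator fun t => ENNReal.ofReal (kernelDensity μ p N t) with hφ
  have hφm : Measurable φ :=
    ((measurable_kernelDensity μ p N).ennreal_ofReal).indicator measurableSet_Ioc
  have hpt : ∀ᵐ r ∂ν, ENNReal.ofReal r * kernelMean μ p N (x * r) ≤
      ENNReal.ofReal C * (1 + ∫⁻ t in Ioo 0 r, φ t) := by
    refine hν.mono fun r hr => ?_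
    have hxr : x * r ∈ Ico (0 : ℝ) 1 :=
      ⟨mul_nonneg hx.1 hr.1.le, by nlinarith [hx.1, hx.2, hr.1, hr.2]⟩
    -- `(0, xr]` lies in both `(0,x]` and `(0,r)`: the cut-off at `x` goes into `φ`, which no longer
    -- depends on `r`, and the cut-off at `r` is left for Tonelli.
    have h1 : ∫⁻ t in Ioc 0 (x * r), ENNReal.ofReal (kernelDensity μ p N t) ≤
        ∫⁻ t in Ioo 0 r, φ t := by
      rw [hφ, setLIntegral_indicator measurableSet_Ioc]
      refine lintegral_mono_set fun t ht => ⟨⟨ht.1, ?_⟩, ht.1, ?_⟩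
      · nlinarith [ht.2, hx.1, hr.2]
      · nlinarith [ht.2, hx.2, hr.1]
    calc ENNReal.ofReal r * kernelMean μ p N (x * r) ≤ 1 * kernelMean μ p N (x * r) := by
          gcongr
          exact ENNReal.ofReal_le_one.2 hr.2.le
      _ ≤ _ := by
          rw [one_mul]
          exact (hle _ hxr).trans (by gcongr)
  have hφx : ∫⁻ t in Ioi 0, φ t * ν (Ioi t) =
      ∫⁻ t in Ioc 0 x, ENNReal.ofReal (kernelDensity μ p N t) * ν (Ioi t) := by
    have : ∀ t, φ t * ν (Ioi t) = (Ioc 0 x).indicator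
        (fun t => ENNReal.ofReal (kernelDensity μ p N t) * ν (Ioi t)) t := by
      intro t
      by_cases ht : t ∈ Ioc 0 x <;> simp [hφ, ht]
    simp_rw [this]
    rw [setLIntegral_indicator measurableSet_Ioc, inter_eq_left.2 Ioc_subset_Ioi_self]
  calc _ ≤ ∫⁻ r, ENNReal.ofReal C * (1 + ∫⁻ t in Ioo 0 r, φ t) ∂ν := lintegral_mono_ae hpt
    _ = ENNReal.ofReal C * (ν univ +
          ∫⁻ t in Ioc 0 x, ENNReal.ofReal (kernelDensity μ p N t) * ν (Ioi t)) := by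
        rw [lintegral_const_mul' _ _ ENNReal.ofReal_ne_top, lintegral_add_left measurable_const,
          lintegral_lintegral_Ioo ν hφm, hφx]
        simp
    _ ≤ ENNReal.ofReal C * (ENNReal.ofReal (ν.real univ + 1) * 1 +
          ENNReal.ofReal (ν.real univ + 1) *
            ∫⁻ t in Ioc 0 x, ENNReal.ofReal (kernelDensity μ p N t) * ν (Ioi t)) := by
        gcongr
        · rw [mul_one, ← ofReal_measureReal]
          exact ENNReal.ofReal_le_ofReal (by linarith)
        · refine le_mul_of_one_le_left zero_le ?_
          rw [← ENNReal.ofReal_one]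
          exact ENNReal.ofReal_le_ofReal (by linarith [measureReal_nonneg (μ := ν) (s := univ)])
    _ = _ := by rw [← mul_add, ← mul_assoc, ← ENNReal.ofReal_mul hC.le, add_comm (1 : ENNReal)]

/-- `kernelDensity` is essentially constant on hyperbolically bounded intervals. -/
theorem kernelDensity_le_mul (h : IsTailDoubling μ) {p : ℝ} (hp : 0 ≤ p) {N : ℕ} (hN : 1 ≤ N)
    {M : ℝ} (hM : 0 < M) : ∃ C > (0 : ℝ), ∀ ρ ∈ Ico (0 : ℝ) 1, ∀ t ∈ Ico (0 : ℝ) 1,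
      1 - t ≤ M * (1 - ρ) → 1 - ρ ≤ M * (1 - t) →
        kernelDensity μ p N t ≤ C * kernelDensity μ p N ρ := by
  obtain ⟨C, hC, β, hle⟩ := h.tail_le
  refine ⟨(M ^ (N - 1) * (C * (1 + M) ^ β)) ^ p, by positivity, fun ρ hρ t ht h1 h2 => ?_⟩
  have hρ1 : 0 < 1 - ρ := by linarith [hρ.2]
  have ht1 : 0 < 1 - t := by linarith [ht.2]
  have hτρ := h.tail_pos ρ hρ
  have hτt := h.tail_pos t ht
  rw [h.kernelDensity_eq p hN ht, h.kernelDensity_eq p hN hρ,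
    ← Real.mul_rpow (by positivity) (by positivity)]
  refine Real.rpow_le_rpow (by positivity) ?_ hp
  have h3 : μ.real (Ioi ρ) ≤ C * (1 + M) ^ β * μ.real (Ioi t) := by
    refine (hle ρ hρ t ht).trans ?_
    have : (1 - ρ) / (1 - t) ≤ M := by rwa [div_le_iff₀ ht1]
    gcongr
  rw [mul_div_assoc', div_le_div_iff₀ hτt hτρ]
  calc (1 - t) ^ (N - 1) * μ.real (Ioi ρ)
      ≤ (M * (1 - ρ)) ^ (N - 1) * (C * (1 + M) ^ β * μ.real (Ioi t)) := by gcongr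
    _ = _ := by rw [mul_pow]; ring

/-- Only the arc `|θ| ≤ η(1-ρ)`, of length `2η(1-ρ)`, is kept; `η ≤ 1` places it inside `(-π, π)`.
-/
theorem le_kernelMean (h : IsTailDoubling μ) {p : ℝ} (hp : 0 ≤ p) {N : ℕ} (hN : 1 ≤ N) :
    ∃ c > (0 : ℝ), ∀ ρ ∈ Ico (0 : ℝ) 1,
      ENNReal.ofReal (c * ((1 - ρ) * kernelDensity μ p N ρ)) ≤ kernelMean μ p N ρ := by
  obtain ⟨c, hc, ε, hε, hle⟩ := h.le_regularized_kernel hp hN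
  set η := min ε 1 with hη
  have hη0 : 0 < η := lt_min hε one_pos
  refine ⟨c * (2 * η), by positivity, fun ρ hρ => ?_⟩
  have hd : 0 < 1 - ρ := by linarith [hρ.2]
  have hd1 : η * (1 - ρ) ≤ 1 := by nlinarith [min_le_right ε 1, hρ.1]
  have hsub : Icc (-(η * (1 - ρ))) (η * (1 - ρ)) ⊆ Ioo (-Real.pi) Real.pi := fun θ hθ =>
    ⟨by linarith [hθ.1, Real.pi_gt_three], by linarith [hθ.2, Real.pi_gt_three]⟩
  calc ENNReal.ofReal (c * (2 * η) * ((1 - ρ) * kernelDensity μ p N ρ))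
      = ∫⁻ _ in Icc (-(η * (1 - ρ))) (η * (1 - ρ)),
          ENNReal.ofReal (c * kernelDensity μ p N ρ) := by
        rw [setLIntegral_const, Real.volume_Icc, ← ENNReal.ofReal_mul
          (mul_nonneg hc.le (h.kernelDensity_nonneg p N hρ))]
        congr 1
        ring
    _ ≤ ∫⁻ θ in Icc (-(η * (1 - ρ))) (η * (1 - ρ)),
          ENNReal.ofReal (‖(1 - circleMap 0 ρ θ) ^ N * kernelSeries μ (circleMap 0 ρ θ)‖ ^ p) := by
        refine setLIntegral_mono' measurableSet_Icc fun θ hθ => ?_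
        refine ENNReal.ofReal_le_ofReal (hle ρ hρ θ ?_)
        refine (abs_le.2 hθ).trans ?_
        gcongr
        exact min_le_left _ _
    _ ≤ _ := lintegral_mono_set hsub

/-- The lower estimate, in terms of the measures induced by the weights. -/
theorem le_lintegral_kernelMean (h : IsTailDoubling μ) {ν : Measure ℝ} [IsFiniteMeasure ν]
    (hν : ∀ᵐ r ∂ν, r ∈ Ioo (0 : ℝ) 1) (hν0 : ν ≠ 0)
    (hshell : ∃ B : ℝ, ∃ δ > (0 : ℝ), ∃ A > (0 : ℝ), ∀ t ∈ Ico (0 : ℝ) 1,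
      ν (Ioi t) ≤ ENNReal.ofReal B *
        ∫⁻ r in Icc (1 - A * (1 - t)) (1 - δ * (1 - t)), ENNReal.ofReal r ∂ν)
    {p : ℝ} (hp : 0 ≤ p) {N : ℕ} (hN : 1 ≤ N) :
    ∃ C > (0 : ℝ), ∀ x ∈ Ico (0 : ℝ) 1,
      (∫⁻ t in Ioc 0 x, ENNReal.ofReal (kernelDensity μ p N t) * ν (Ioi t)) + 1 ≤
        ENNReal.ofReal C * ∫⁻ r, ENNReal.ofReal r * kernelMean μ p N (x * r) ∂ν := by
  have := h.isFinite
  obtain ⟨B, δ, hδ, A, hA, hsh⟩ := hshell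
  obtain ⟨c, hc, hmean⟩ := h.le_kernelMean hp hN
  -- For `r` in the shell of `t` and `t ≤ x`, the numbers `1-t` and `1-xr` are comparable: `1-t ≤
  -- (1-r)/δ ≤ (1-xr)/δ`, and `1-xr ≤ (1-r)+(1-x) ≤ (A+1)(1-t)`.
  obtain ⟨D, hD, hcomp⟩ := h.kernelDensity_le_mul hp hN (M := max (1 / δ) (A + 1)) (by positivity)
  set H := kernelDensity μ p N with hH
  have hHm : Measurable H := measurable_kernelDensity μ p N
  set V : ℝ → ENNReal :=
    fun x => ∫⁻ r, ENNReal.ofReal r * ENNReal.ofReal ((1 - x * r) * H (x * r)) ∂ν with hV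
  have hxr : ∀ x ∈ Ico (0 : ℝ) 1, ∀ r ∈ Ioo (0 : ℝ) 1, x * r ∈ Ico (0 : ℝ) 1 :=
    fun x hx r hr => ⟨mul_nonneg hx.1 hr.1.le, by nlinarith [hx.1, hx.2, hr.1, hr.2]⟩
  have hVI : ∀ x ∈ Ico (0 : ℝ) 1, ENNReal.ofReal c * V x ≤
      ∫⁻ r, ENNReal.ofReal r * kernelMean μ p N (x * r) ∂ν := by
    intro x hx
    rw [hV, ← lintegral_const_mul' _ _ ENNReal.ofReal_ne_top]
    refine lintegral_mono_ae (hν.mono fun r hr => ?_)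
    have := hmean _ (hxr x hx r hr)
    rw [ENNReal.ofReal_mul hc.le] at this
    calc _ = ENNReal.ofReal r * (ENNReal.ofReal c * ENNReal.ofReal ((1 - x * r) * H (x * r))) := by
          ring
      _ ≤ _ := by gcongr
  -- This accounts for the `+ 1`: `V x` is bounded below uniformly in `x`. The minorant `f` is
  -- independent of `x`, by `1-xr ≥ 1-r` and `τ(xr) ≤ τ(0)`, and it is positive almost everywhere
  -- for `ν ≠ 0`.
  have hsmall : ∃ κ > (0 : ℝ), ∀ x ∈ Ico (0 : ℝ) 1, 1 ≤ ENNReal.ofReal κ * V x := by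
    have hτ0 := h.tail_pos 0 ⟨le_rfl, one_pos⟩
    set f : ℝ → ENNReal := fun r => ENNReal.ofReal r *
      ENNReal.ofReal ((1 - r) * ((1 - r) ^ (N - 1) / μ.real (Ioi 0)) ^ p) with hf
    have hfm : Measurable f := by fun_prop
    have hpos : 0 < ∫⁻ r, f r ∂ν := by
      rw [lintegral_pos_iff_support hfm]
      have : ν (Function.support f)ᶜ = 0 := by
        refine measure_eq_zero_iff_ae_notMem.2 (hν.mono fun r hr => ?_)
        have h1 : 0 < 1 - r := by linarith [hr.2]
        simp only [mem_compl_iff, Function.mem_support, not_not, hf]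
        exact mul_ne_zero (ENNReal.ofReal_pos.2 hr.1).ne' (ENNReal.ofReal_pos.2 (by positivity)).ne'
      rw [measure_of_measure_compl_eq_zero this]
      exact Measure.measure_univ_pos.2 hν0
    obtain ⟨q, hq0, hq1, hq2⟩ := ENNReal.lt_iff_exists_real_btwn.1 hpos
    have hq : 0 < q := ENNReal.ofReal_pos.1 hq1
    refine ⟨q⁻¹, inv_pos.2 hq, fun x hx => ?_⟩
    have hfV : ∫⁻ r, f r ∂ν ≤ V x := by
      refine lintegral_mono_ae (hν.mono fun r hr => ?_)
      have hm := hxr x hx r hr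
      have h1 : 0 < 1 - r := by linarith [hr.2]
      have h2 : 1 - r ≤ 1 - x * r := by nlinarith [hx.2, hr.1]
      have hτ := h.tail_pos _ hm
      simp only [hf]
      rw [hH, h.kernelDensity_eq p hN hm]
      refine mul_le_mul' le_rfl (ENNReal.ofReal_le_ofReal ?_)
      refine mul_le_mul h2 (Real.rpow_le_rpow (by positivity) ?_ hp) (by positivity) (by linarith)
      exact div_le_div₀ (pow_nonneg (h1.le.trans h2) _) (pow_le_pow_left₀ h1.le h2 _) hτ
        (tail_antitone μ hm.1)
    calc (1 : ENNReal) = ENNReal.ofReal q⁻¹ * ENNReal.ofReal q := by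
          rw [← ENNReal.ofReal_mul (inv_pos.2 hq).le, inv_mul_cancel₀ hq.ne', ENNReal.ofReal_one]
      _ ≤ _ := by gcongr; exact hq2.le.trans hfV
  have hmain : ∀ x ∈ Ico (0 : ℝ) 1,
      ∫⁻ t in Ioc 0 x, ENNReal.ofReal (H t) * ν (Ioi t) ≤
        ENNReal.ofReal (max B 0 * (D / δ)) * V x := by
    intro x hx
    -- `S` consists of the pairs `(t,r)` with `r` in the shell of `t`; the tail `ν(t,1)` is replaced
    -- by the mass of this slice before the integrals are exchanged.
    set S : Set (ℝ × ℝ) :=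
      {q | 1 - A * (1 - q.1) ≤ q.2 ∧ q.2 ≤ 1 - δ * (1 - q.1)} with hS
    have hSm : MeasurableSet S :=
      (measurableSet_le (f := fun q : ℝ × ℝ => 1 - A * (1 - q.1)) (g := fun q => q.2)
        (by fun_prop) (by fun_prop)).inter
      (measurableSet_le (f := fun q : ℝ × ℝ => q.2) (g := fun q => 1 - δ * (1 - q.1))
        (by fun_prop) (by fun_prop))
    set k : ℝ → ℝ → ENNReal := fun t r =>
      S.indicator (fun q => ENNReal.ofReal q.2 * ENNReal.ofReal (H q.1)) (t, r) with hk
    have hkm : Measurable (Function.uncurry k) :=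
      Measurable.indicator (by fun_prop) hSm
    have h1 : ∀ t ∈ Ioc 0 x, ENNReal.ofReal (H t) * ν (Ioi t) ≤
        ENNReal.ofReal (max B 0) * ∫⁻ r, k t r ∂ν := by
      intro t ht
      have ht' : t ∈ Ico (0 : ℝ) 1 := ⟨ht.1.le, ht.2.trans_lt hx.2⟩
      have e : ∫⁻ r, k t r ∂ν = ENNReal.ofReal (H t) *
          ∫⁻ r in Icc (1 - A * (1 - t)) (1 - δ * (1 - t)), ENNReal.ofReal r ∂ν := by
        rw [← lintegral_const_mul' _ _ ENNReal.ofReal_ne_top,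
          ← lintegral_indicator measurableSet_Icc]
        refine lintegral_congr fun r => ?_
        by_cases hr : r ∈ Icc (1 - A * (1 - t)) (1 - δ * (1 - t))
        · rw [indicator_of_mem hr, hk]
          simp only
          rw [indicator_of_mem (show (t, r) ∈ S from hr), mul_comm]
        · rw [indicator_of_notMem hr, hk]
          simp only
          rw [indicator_of_notMem (show (t, r) ∉ S from hr)]
      rw [e]
      calc _ ≤ ENNReal.ofReal (H t) * (ENNReal.ofReal (max B 0) *
            ∫⁻ r in Icc (1 - A * (1 - t)) (1 - δ * (1 - t)), ENNReal.ofReal r ∂ν) := by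
            gcongr
            refine (hsh t ht').trans ?_
            gcongr
            exact le_max_left _ _
        _ = _ := by ring
    -- For fixed `r` the condition `r ≤ 1 - δ(1-t)` confines `t` to an interval of length `(1-r)/δ ≤
    -- (1-xr)/δ`, on whose part inside `S` one has `H(t) ≤ D H(xr)`.
    have h2 : ∀ r ∈ Ioo (0 : ℝ) 1, ∫⁻ t in Ioc 0 x, k t r ≤
        ENNReal.ofReal (D / δ) *
          (ENNReal.ofReal r * ENNReal.ofReal ((1 - x * r) * H (x * r))) := by
      intro r hr
      have hm := hxr x hx r hr
      have hHρ := h.kernelDensity_nonneg p N hm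
      have hpt : ∀ t ∈ Ioc 0 x, k t r ≤ (Icc (1 - (1 - r) / δ) 1).indicator
          (fun _ => ENNReal.ofReal r * ENNReal.ofReal (D * H (x * r))) t := by
        intro t ht
        have ht' : t ∈ Ico (0 : ℝ) 1 := ⟨ht.1.le, ht.2.trans_lt hx.2⟩
        have ht1 : 0 < 1 - t := by linarith [ht'.2]
        by_cases hmem : (t, r) ∈ S
        · have h3 : 1 - A * (1 - t) ≤ r := hmem.1
          have h4 : r ≤ 1 - δ * (1 - t) := hmem.2
          have h5 : 1 - t ≤ (1 - r) / δ := by rw [le_div_iff₀ hδ]; linarith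
          have h6 : 1 - r ≤ 1 - x * r := by nlinarith [hx.2, hr.1]
          rw [hk]
          simp only
          rw [indicator_of_mem hmem, indicator_of_mem (show t ∈ Icc (1 - (1 - r) / δ) 1 from
            ⟨by linarith, ht'.2.le⟩)]
          gcongr
          refine hcomp _ hm t ht' ?_ ?_
          · calc 1 - t ≤ 1 / δ * (1 - r) := by rw [one_div_mul_eq_div]; exact h5
              _ ≤ max (1 / δ) (A + 1) * (1 - x * r) := by
                gcongr
                · linarith [hr.2]
                · exact le_max_left _ _
          · calc 1 - x * r ≤ (1 - r) + (1 - x) := by nlinarith [hx.2, hr.2]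
              _ ≤ (A + 1) * (1 - t) := by linarith [ht.2]
              _ ≤ _ := by gcongr; exact le_max_right _ _
        · rw [hk]
          simp only
          rw [indicator_of_notMem hmem]
          exact zero_le
      calc ∫⁻ t in Ioc 0 x, k t r
          ≤ ∫⁻ t in Ioc 0 x, (Icc (1 - (1 - r) / δ) 1).indicator
              (fun _ => ENNReal.ofReal r * ENNReal.ofReal (D * H (x * r))) t :=
            setLIntegral_mono' measurableSet_Ioc hpt
        _ ≤ ∫⁻ t, (Icc (1 - (1 - r) / δ) 1).indicator
              (fun _ => ENNReal.ofReal r * ENNReal.ofReal (D * H (x * r))) t :=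
            setLIntegral_le_lintegral _ _
        _ = ENNReal.ofReal r * (ENNReal.ofReal (D * H (x * r)) *
              ENNReal.ofReal ((1 - r) / δ)) := by
            rw [lintegral_indicator measurableSet_Icc, setLIntegral_const, Real.volume_Icc,
              sub_sub_cancel, mul_assoc]
        _ ≤ ENNReal.ofReal r * (ENNReal.ofReal (D / δ) *
              ENNReal.ofReal ((1 - x * r) * H (x * r))) := by
            rw [← ENNReal.ofReal_mul (mul_nonneg hD.le hHρ),
              ← ENNReal.ofReal_mul (p := D / δ) (by positivity)]
            refine mul_le_mul' le_rfl (ENNReal.ofReal_le_ofReal ?_)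
            have h6 : 1 - r ≤ 1 - x * r := by nlinarith [hx.2, hr.1]
            calc D * H (x * r) * ((1 - r) / δ) ≤ D * H (x * r) * ((1 - x * r) / δ) := by
                  have := mul_nonneg hD.le hHρ
                  gcongr
              _ = _ := by ring
        _ = _ := by ring
    calc _ ≤ ∫⁻ t in Ioc 0 x, ENNReal.ofReal (max B 0) * ∫⁻ r, k t r ∂ν :=
          setLIntegral_mono' measurableSet_Ioc h1
      _ = ENNReal.ofReal (max B 0) * ∫⁻ r, (∫⁻ t in Ioc 0 x, k t r) ∂ν := by
          rw [lintegral_const_mul' _ _ ENNReal.ofReal_ne_top,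
            lintegral_lintegral_swap hkm.aemeasurable]
      _ ≤ ENNReal.ofReal (max B 0) * (ENNReal.ofReal (D / δ) * V x) := by
          gcongr
          rw [hV, ← lintegral_const_mul' _ _ ENNReal.ofReal_ne_top]
          exact lintegral_mono_ae (hν.mono h2)
      _ = _ := by rw [← mul_assoc, ← ENNReal.ofReal_mul (le_max_right _ _)]
  obtain ⟨κ, hκ, hone⟩ := hsmall
  have hE : 0 ≤ max B 0 * (D / δ) := mul_nonneg (le_max_right _ _) (by positivity)
  refine ⟨(max B 0 * (D / δ) + κ) / c, by positivity, fun x hx => ?_⟩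
  calc _ ≤ ENNReal.ofReal (max B 0 * (D / δ)) * V x + ENNReal.ofReal κ * V x :=
        add_le_add (hmain x hx) (hone x hx)
    _ = ENNReal.ofReal ((max B 0 * (D / δ) + κ) / c) * (ENNReal.ofReal c * V x) := by
        rw [← add_mul, ← ENNReal.ofReal_add hE hκ.le, ← mul_assoc,
          ← ENNReal.ofReal_mul (by positivity), div_mul_cancel₀ _ hc.ne']
    _ ≤ _ := by gcongr; exact hVI x hx

end IsTailDoubling

/-! ### The class `ℳ` and the mass of shells -/

/-- If the moments decrease geometrically, then the tail at `t` is controlled by the mass of an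
interval whose distance to `1` is comparable to `1 - t`. -/
theorem IsTailDoubling.tail_le_lintegral_shell {ν : Measure ℝ} (h : IsTailDoubling ν)
    (hM : ∃ C > (1 : ℝ), ∃ K > (1 : ℝ), ∀ x : ℝ, 1 ≤ x →
      C * ∫ r, r ^ (K * x) ∂ν ≤ ∫ r, r ^ x ∂ν) :
    ∃ B : ℝ, ∃ δ > (0 : ℝ), ∃ A > (0 : ℝ), ∀ t ∈ Ico (0 : ℝ) 1,
      ν (Ioi t) ≤ ENNReal.ofReal B *
        ∫⁻ r in Icc (1 - A * (1 - t)) (1 - δ * (1 - t)), ENNReal.ofReal r ∂ν := by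
  have := h.isFinite
  obtain ⟨C, hC, K, hK, hmom⟩ := hM
  obtain ⟨E, hE, hup⟩ := h.moment_le
  obtain ⟨D, hD, hlow⟩ := h.le_moment
  obtain ⟨L, hL⟩ := exists_nat_gt K
  have hL0 : (0 : ℝ) < L := by linarith
  have hpow : ∀ k : ℕ, Integrable (fun r : ℝ => r ^ k) ν :=
    fun k => h.integrable_of_continuous (by fun_prop)
  -- For `0 < r < 1` the moments decrease in the exponent, so the real factor `K` may be enlarged to
  -- the integer `L`, and natural powers suffice from here on.
  have hmomL : ∀ n : ℕ, C * ∫ r, r ^ (L * (2 * n + 1)) ∂ν ≤ ∫ r, r ^ (2 * n + 1) ∂ν := by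
    intro n
    have h1 := hmom ((2 * n + 1 : ℕ) : ℝ) (by exact_mod_cast Nat.le_add_left 1 (2 * n))
    simp_rw [Real.rpow_natCast] at h1
    refine le_trans ?_ h1
    refine mul_le_mul_of_nonneg_left ?_ (by linarith)
    have hx : (0 : ℝ) < ((2 * n + 1 : ℕ) : ℝ) := by positivity
    refine integral_mono_ae (hpow _) ?_ (h.ae_mem.mono fun r hr => ?_)
    · refine Integrable.of_bound (C := 1)
        (measurable_id.pow_const _).aestronglyMeasurable (h.ae_mem.mono fun r hr => ?_)
      rw [Real.norm_of_nonneg (Real.rpow_nonneg hr.1.le _)]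
      exact Real.rpow_le_one hr.1.le hr.2.le (by positivity)
    · simp only
      rw [← Real.rpow_natCast]
      refine Real.rpow_le_rpow_of_exponent_ge hr.1 hr.2.le ?_
      rw [Nat.cast_mul]
      gcongr
  -- The moment condition gives `∫ r^(2n+1) ≤ C/(C-1) · ∫ (r^(2n+1) - r^(L(2n+1)))`, hence `τ ≤ D' ∫
  -- (r^(2n+1) - r^(L(2n+1)))`. The parameters `δ` and `A` are then chosen so that the parts of this
  -- integral too close to `1` and too far from `1` account for at most `τ/4` each.
  set D' : ℝ := D * (C / (C - 1)) with hD'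
  have hC1 : 0 < C - 1 := by linarith
  have hD'0 : 0 < D' := by positivity
  set δ : ℝ := min 1 (1 / (8 * L * D')) with hδ
  have hδ0 : 0 < δ := by positivity
  have hδ1 : δ ≤ 1 := min_le_left _ _
  have hδ2 : D' * (2 * L * δ) ≤ 1 / 4 := by
    calc D' * (2 * L * δ) ≤ D' * (2 * L * (1 / (8 * L * D'))) := by
          gcongr; exact min_le_right _ _
      _ = 1 / 4 := by field_simp; norm_num
  set A : ℝ := max 1 (Real.log (4 * D' * E)) with hA
  have hA0 : 0 < A := lt_max_of_lt_left one_pos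
  have hA2 : D' * (Real.exp (-A) * E) ≤ 1 / 4 := by
    have h1 : 4 * D' * E ≤ Real.exp A := by
      rw [← Real.log_le_iff_le_exp (by positivity)]; exact le_max_right _ _
    rw [Real.exp_neg, ← div_eq_inv_mul, mul_div_assoc', div_le_iff₀ (Real.exp_pos A)]
    linarith
  -- `2 * D'` results from absorbing `τ/2` on the left. `2 * A` is needed because only `(n+1)(1-t) ≥
  -- 1/2` is known.
  refine ⟨2 * D', δ, hδ0, 2 * A, by positivity, fun t ht => ?_⟩
  obtain ⟨n, hn1, hn2⟩ := exists_one_sub_inv_near ht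
  have hn : (0 : ℝ) < (n : ℝ) + 1 := by positivity
  set τ := ν.real (Ioi (1 - 1 / ((n : ℝ) + 1))) with hτ
  have hτ0 : 0 ≤ τ := measureReal_nonneg
  have ht1 : 0 < 1 - t := by linarith [ht.2]
  set I₁ : Set ℝ := Ioi (1 - δ / ((n : ℝ) + 1)) with hI₁
  set I₂ : Set ℝ := Icc (1 - 2 * A * (1 - t)) (1 - δ * (1 - t)) with hI₂
  have hτt : ν.real (Ioi t) ≤ τ := by
    refine tail_antitone ν ?_
    have : 1 - t ≤ 1 / ((n : ℝ) + 1) := by rw [le_div_iff₀ hn]; linarith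
    linarith
  have hτ1 : ν.real I₁ ≤ τ := by
    refine tail_antitone ν ?_
    have : δ / ((n : ℝ) + 1) ≤ 1 / ((n : ℝ) + 1) := by gcongr
    linarith
  -- Three regions. On `I₁`, next to `1`, Bernoulli's inequality bounds the difference by
  -- `L(2n+1)(1-r) ≤ 2Lδ`; on the shell `I₂` it is at most `r`; further from `1`, `r^(n+1) ≤
  -- e^(-A)`.
  have hpt : ∀ r ∈ Ioo (0 : ℝ) 1, r ^ (2 * n + 1) - r ^ (L * (2 * n + 1)) ≤
      I₁.indicator (fun _ => 2 * L * δ) r + Real.exp (-A) * r ^ n +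
        I₂.indicator (fun r => r) r := by
    intro r hr
    have hr0 := hr.1
    have hn0 : 0 ≤ r ^ (L * (2 * n + 1)) := pow_nonneg hr0.le _
    have hi1 : 0 ≤ I₁.indicator (fun _ => 2 * L * δ) r :=
      indicator_nonneg (fun _ _ => by positivity) _
    have hi2 : 0 ≤ I₂.indicator (fun r => r) r := by
      by_cases hmem : r ∈ I₂
      · rw [indicator_of_mem hmem]; exact hr0.le
      · rw [indicator_of_notMem hmem]
    have hi3 : 0 ≤ Real.exp (-A) * r ^ n := by positivity
    by_cases h1 : r ∈ I₁
    · have h2 : 1 - r ≤ δ / ((n : ℝ) + 1) := by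
        have : 1 - δ / ((n : ℝ) + 1) < r := h1
        linarith
      rw [le_div_iff₀ hn] at h2
      have h3 := one_add_mul_sub_le_pow (a := r) (by linarith) (L * (2 * n + 1))
      have h4 : r ^ (2 * n + 1) ≤ 1 := pow_le_one₀ hr0.le hr.2.le
      have h5 : ((L * (2 * n + 1) : ℕ) : ℝ) * (1 - r) ≤ 2 * L * δ := by
        push_cast
        have : (2 * (n : ℝ) + 1) * (1 - r) ≤ 2 * δ := by nlinarith [hr.2]
        nlinarith
      rw [indicator_of_mem h1]
      nlinarith
    · have h1' : r ≤ 1 - δ / ((n : ℝ) + 1) := not_lt.1 h1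
      by_cases h2 : r ∈ I₂
      · have h3 : r ^ (2 * n + 1) ≤ r := by
          calc r ^ (2 * n + 1) ≤ r ^ 1 := pow_le_pow_of_le_one hr0.le hr.2.le (by omega)
            _ = r := pow_one r
        rw [indicator_of_mem h2]
        linarith
      · have h3 : r < 1 - 2 * A * (1 - t) := by
          by_contra hcon
          refine h2 ⟨not_lt.1 hcon, h1'.trans ?_⟩
          have : δ * (1 - t) ≤ δ / ((n : ℝ) + 1) := by
            rw [le_div_iff₀ hn]; nlinarith
          linarith
        have h4 : A ≤ ((n + 1 : ℕ) : ℝ) * (1 - r) := by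
          push_cast
          have h6 : ((n : ℝ) + 1) * (2 * A * (1 - t)) ≤ ((n : ℝ) + 1) * (1 - r) := by
            gcongr; linarith
          nlinarith [mul_nonneg (n.cast_nonneg (α := ℝ)) ht1.le]
        have h5 : r ^ (n + 1) ≤ Real.exp (-A) :=
          (pow_le_exp hr0.le (n + 1)).trans (Real.exp_le_exp.2 (by linarith))
        have h6 : r ^ (2 * n + 1) ≤ Real.exp (-A) * r ^ n := by
          rw [show 2 * n + 1 = (n + 1) + n by ring, pow_add]
          gcongr
        linarith
  have hint1 : Integrable (I₁.indicator fun _ : ℝ => 2 * L * δ) ν :=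
    (integrable_const _).indicator measurableSet_Ioi
  have hint2 : Integrable (fun r : ℝ => Real.exp (-A) * r ^ n) ν := (hpow n).const_mul _
  have hid : Integrable (fun r : ℝ => r) ν := h.integrable_of_continuous continuous_id
  have hint3 : Integrable (I₂.indicator fun r : ℝ => r) ν := hid.indicator measurableSet_Icc
  have h1 : ∫ r, (r ^ (2 * n + 1) - r ^ (L * (2 * n + 1))) ∂ν ≤
      ν.real I₁ * (2 * L * δ) + Real.exp (-A) * ∫ r, r ^ n ∂ν + ∫ r in I₂, r ∂ν := by
    refine (integral_mono_ae ((hpow _).sub (hpow _)) ((hint1.add hint2).add hint3)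
      (h.ae_mem.mono hpt)).trans_eq ?_
    have e1 := integral_add (hint1.add hint2) hint3
    have e2 := integral_add hint1 hint2
    rw [integral_indicator measurableSet_Ioi, setIntegral_const, smul_eq_mul,
      integral_const_mul] at e2
    rw [integral_indicator measurableSet_Icc] at e1
    rw [← e2]
    exact e1
  rw [integral_sub (hpow _) (hpow _)] at h1
  have h2 : ∫ r, r ^ (2 * n + 1) ∂ν ≤ C / (C - 1) *
      (∫ r, r ^ (2 * n + 1) ∂ν - ∫ r, r ^ (L * (2 * n + 1)) ∂ν) := by
    rw [div_mul_eq_mul_div, le_div_iff₀ hC1]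
    linarith [hmomL n]
  have h3 : τ ≤ D' * (τ * (2 * L * δ) + Real.exp (-A) * (E * τ) + ∫ r in I₂, r ∂ν) := by
    calc τ ≤ D * ∫ r, r ^ (2 * n + 1) ∂ν := hlow n
      _ ≤ D * (C / (C - 1) *
          (ν.real I₁ * (2 * L * δ) + Real.exp (-A) * ∫ r, r ^ n ∂ν + ∫ r in I₂, r ∂ν)) := by
          gcongr
          exact h2.trans (by gcongr)
      _ = D' * (ν.real I₁ * (2 * L * δ) + Real.exp (-A) * ∫ r, r ^ n ∂ν + ∫ r in I₂, r ∂ν) := by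
          rw [hD']; ring
      _ ≤ _ := by
          gcongr
          exact hup n
  have h4 : τ ≤ 2 * D' * ∫ r in I₂, r ∂ν := by
    nlinarith [mul_le_mul_of_nonneg_right hδ2 hτ0, mul_le_mul_of_nonneg_right hA2 hτ0]
  have h5 : ENNReal.ofReal (∫ r in I₂, r ∂ν) = ∫⁻ r in I₂, ENNReal.ofReal r ∂ν :=
    ofReal_integral_eq_lintegral_ofReal hid.integrableOn
      (ae_restrict_of_ae (h.ae_mem.mono fun r hr => hr.1.le))
  rw [← h5, ← ENNReal.ofReal_mul (by positivity), ← ofReal_measureReal]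
  exact ENNReal.ofReal_le_ofReal (hτt.trans h4)

/-! ### The measure induced by a radial weight -/

/-- The measure `ω(r) dr` on `(0,1)`. -/
noncomputable def weightMeasure (ω : ℝ → ℝ) : Measure ℝ :=
  (volume.restrict (Ioo 0 1)).withDensity fun r => ENNReal.ofReal (ω r)

namespace IsRadialWeight

variable {ω : ℝ → ℝ}

theorem integrableOn_Ioo (hω : IsRadialWeight ω) : IntegrableOn ω (Ioo 0 1) :=
  hω.integrable.mono_set Ioo_subset_Ico_self

theorem isFiniteMeasure (hω : IsRadialWeight ω) : IsFiniteMeasure (weightMeasure ω) :=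
  isFiniteMeasure_withDensity_ofReal hω.integrableOn_Ioo.2

theorem aemeasurable_ofReal (hω : IsRadialWeight ω) :
    AEMeasurable (fun r => ENNReal.ofReal (ω r)) (volume.restrict (Ioo 0 1)) :=
  hω.integrableOn_Ioo.1.aemeasurable.ennreal_ofReal

theorem ae_mem (_hω : IsRadialWeight ω) : ∀ᵐ r ∂weightMeasure ω, r ∈ Ioo (0 : ℝ) 1 :=
  (withDensity_absolutelyContinuous _ _).ae_le (ae_restrict_mem measurableSet_Ioo)

/-- As the density is finite, `f` may be arbitrary; the formula thus applies to circle means without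
checking their measurability in `r`. -/
theorem lintegral_weightMeasure (hω : IsRadialWeight ω) (f : ℝ → ENNReal) :
    ∫⁻ r, f r ∂weightMeasure ω = ∫⁻ r in Ioo 0 1, ENNReal.ofReal (ω r) * f r :=
  lintegral_withDensity_eq_lintegral_mul_non_measurable₀ _ hω.aemeasurable_ofReal
    (Filter.Eventually.of_forall fun _ => ENNReal.ofReal_lt_top) f

theorem measure_Ioi (hω : IsRadialWeight ω) {t : ℝ} (ht : t ∈ Ico (0 : ℝ) 1) :
    weightMeasure ω (Ioi t) = ENNReal.ofReal (weightTail ω t) := by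
  have hsub : Ioo t 1 ⊆ Ioo (0 : ℝ) 1 := Ioo_subset_Ioo_left ht.1
  have hset : Ioi t ∩ Ioo (0 : ℝ) 1 = Ioo t 1 := by
    ext r
    constructor
    · exact fun h => ⟨h.1, h.2.2⟩
    · exact fun h => ⟨h.1, hsub h⟩
  unfold weightMeasure weightTail
  rw [withDensity_apply _ measurableSet_Ioi, Measure.restrict_restrict measurableSet_Ioi, hset,
    intervalIntegral.integral_of_le ht.2.le, integral_Ioc_eq_integral_Ioo,
    ofReal_integral_eq_lintegral_ofReal (hω.integrableOn_Ioo.mono_set hsub)]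
  refine (ae_restrict_iff' measurableSet_Ioo).2 (Filter.Eventually.of_forall fun r hr => ?_)
  exact hω.nonneg r ⟨(hsub hr).1.le, hr.2⟩

theorem measureReal_Ioi (hω : IsRadialWeight ω) {t : ℝ} (ht : t ∈ Ico (0 : ℝ) 1) :
    (weightMeasure ω).real (Ioi t) = weightTail ω t := by
  rw [Measure.real, hω.measure_Ioi ht, ENNReal.toReal_ofReal (hω.tail_pos t ht).le]

theorem integral_rpow (hω : IsRadialWeight ω) (x : ℝ) :
    ∫ r, r ^ x ∂weightMeasure ω = weightMoment ω x := by
  unfold weightMeasure weightMoment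
  rw [integral_withDensity_eq_integral_toReal_smul₀ hω.aemeasurable_ofReal
    (Filter.Eventually.of_forall fun _ => ENNReal.ofReal_lt_top),
    intervalIntegral.integral_of_le zero_le_one, integral_Ioc_eq_integral_Ioo]
  refine setIntegral_congr_fun measurableSet_Ioo fun r hr => ?_
  simp only [smul_eq_mul]
  rw [ENNReal.toReal_ofReal (hω.nonneg r ⟨hr.1.le, hr.2⟩), mul_comm]

theorem integral_pow (hω : IsRadialWeight ω) (n : ℕ) :
    ∫ r, r ^ (2 * n + 1) ∂weightMeasure ω = weightMoment ω (2 * n + 1) := by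
  rw [← hω.integral_rpow]
  refine integral_congr_ae (Filter.Eventually.of_forall fun r => ?_)
  simp only
  rw [← Real.rpow_natCast]
  push_cast
  rfl

theorem weightMeasure_ne_zero (hω : IsRadialWeight ω) : weightMeasure ω ≠ 0 := by
  intro h
  have h1 := hω.measureReal_Ioi (t := 0) ⟨le_rfl, one_pos⟩
  have h2 := hω.tail_pos 0 ⟨le_rfl, one_pos⟩
  rw [h] at h1
  simp at h1
  linarith

end IsRadialWeight

theorem MemDHat.isTailDoubling {ω : ℝ → ℝ} (hω : MemDHat ω) : IsTailDoubling (weightMeasure ω) where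
  isFinite := hω.1.isFiniteMeasure
  ae_mem := hω.1.ae_mem
  tail_pos t ht := by rw [hω.1.measureReal_Ioi ht]; exact hω.1.tail_pos t ht
  doubling := by
    obtain ⟨C, -, hC⟩ := hω.2
    refine ⟨C, fun t ht => ?_⟩
    rw [hω.1.measureReal_Ioi ht,
      hω.1.measureReal_Ioi ⟨by linarith [ht.1], by linarith [ht.2]⟩]
    exact hC t ht

theorem bergmanKernel_eq_kernelSeries {ω : ℝ → ℝ} (hω : IsRadialWeight ω) {z ζ : ℂ}
    (hz : z ∈ ball (0 : ℂ) 1) (hζ : ζ ∈ ball (0 : ℂ) 1) :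
    bergmanKernel ω z ζ = kernelSeries (weightMeasure ω) (conj z * ζ) := by
  rw [IsBergmanKernelAt.eqOn hω (isBergmanKernelAt_bergmanKernel hω hz)
    (isBergmanKernelAt_tsum hω hz) hζ]
  unfold kernelSeries kernelCoeff
  refine tsum_congr fun n => ?_
  rw [hω.integral_pow n, Complex.ofReal_inv, div_eq_inv_mul]

/-! ### Polar coordinates and rotations in the disc -/

theorem lintegral_diskArea_polar {ν : ℝ → ℝ} (hν : IsRadialWeight ν) {F : ℂ → ℝ}
    (hF : ContinuousOn F (ball 0 1)) (hF0 : ∀ ζ, 0 ≤ F ζ) :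
    ∫⁻ ζ, ENNReal.ofReal (F ζ * ν ‖ζ‖) ∂diskArea = ENNReal.ofReal Real.pi⁻¹ *
      ∫⁻ r, ENNReal.ofReal r * (∫⁻ θ in Ioo (-Real.pi) Real.pi,
        ENNReal.ofReal (F (circleMap 0 r θ))) ∂weightMeasure ν := by
  unfold diskArea
  rw [lintegral_smul_measure, smul_eq_mul, ← lintegral_indicator measurableSet_ball,
    ← Complex.lintegral_comp_polarCoord_symm, hν.lintegral_weightMeasure]
  congr 1
  set f : ℝ × ℝ → ENNReal := fun q =>
    ENNReal.ofReal (ν q.1) * (ENNReal.ofReal q.1 * ENNReal.ofReal (F (circleMap 0 q.1 q.2))) with hf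
  have hsym : ∀ q : ℝ × ℝ, Complex.polarCoord.symm q = circleMap 0 q.1 q.2 := by
    intro q
    simp [circleMap, Complex.exp_mul_I]
  have hcont : Continuous fun q : ℝ × ℝ => circleMap 0 q.1 q.2 := by
    simp only [circleMap]
    fun_prop
  have h1 : ∀ q ∈ polarCoord.target, ENNReal.ofReal q.1 •
      (ball (0 : ℂ) 1).indicator (fun ζ => ENNReal.ofReal (F ζ * ν ‖ζ‖))
        (Complex.polarCoord.symm q) = (Ioo (0 : ℝ) 1 ×ˢ univ).indicator f q := by
    intro q hq
    have hq0 : 0 < q.1 := hq.1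
    have hn : ‖circleMap 0 q.1 q.2‖ = q.1 := by rw [norm_circleMap_zero, abs_of_pos hq0]
    rw [hsym]
    by_cases h : q.1 < 1
    · rw [indicator_of_mem (show circleMap 0 q.1 q.2 ∈ ball (0 : ℂ) 1 by
        rw [mem_ball_zero_iff, hn]; exact h), indicator_of_mem (show q ∈ Ioo (0 : ℝ) 1 ×ˢ univ from
        ⟨⟨hq0, h⟩, trivial⟩), hn, ENNReal.ofReal_mul (hF0 _), hf, smul_eq_mul]
      ring
    · rw [indicator_of_notMem (show circleMap 0 q.1 q.2 ∉ ball (0 : ℂ) 1 by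
        rw [mem_ball_zero_iff, hn]; exact h), indicator_of_notMem (fun h' => h h'.1.2), smul_zero]
  have hset : Ioo (0 : ℝ) 1 ×ˢ univ ∩ polarCoord.target =
      Ioo (0 : ℝ) 1 ×ˢ Ioo (-Real.pi) Real.pi := by
    rw [polarCoord_target, prod_inter_prod, univ_inter, inter_eq_left.2 Ioo_subset_Ioi_self]
  -- `ν` is only almost everywhere measurable on `(0,1)` and `F` only continuous on the disc, so
  -- measurability is claimed on this rectangle alone.
  have hmeas : AEMeasurable f ((volume.prod volume).restrict
      (Ioo (0 : ℝ) 1 ×ˢ Ioo (-Real.pi) Real.pi)) := by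
    refine AEMeasurable.mul ?_ (AEMeasurable.mul measurable_fst.ennreal_ofReal.aemeasurable ?_)
    · rw [← Measure.prod_restrict]
      exact hν.aemeasurable_ofReal.comp_quasiMeasurePreserving Measure.quasiMeasurePreserving_fst
    · refine (ContinuousOn.aemeasurable ?_
        (measurableSet_Ioo.prod measurableSet_Ioo)).ennreal_ofReal
      refine hF.comp hcont.continuousOn fun q hq => ?_
      rw [mem_ball_zero_iff, norm_circleMap_zero, abs_of_pos hq.1.1]
      exact hq.1.2
  rw [setLIntegral_congr_fun polarCoord.open_target.measurableSet h1,
    setLIntegral_indicator (measurableSet_Ioo.prod MeasurableSet.univ), hset,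
    Measure.volume_eq_prod, setLIntegral_prod f hmeas]
  refine lintegral_congr fun r => ?_
  simp only [hf]
  rw [lintegral_const_mul' _ _ ENNReal.ofReal_ne_top,
    lintegral_const_mul' _ _ ENNReal.ofReal_ne_top]

/-- Since `ν(|ζ|)` is invariant under rotations, this allows `conj z` to be replaced by `|z|`. -/
theorem measurePreserving_rotation_diskArea (a : Circle) :
    MeasurePreserving (rotation a) diskArea diskArea := by
  unfold diskArea
  refine MeasurePreserving.smul_measure ?_ _
  have h := (rotation a).measurePreserving.restrict_preimage
    (measurableSet_ball : MeasurableSet (ball (0 : ℂ) 1))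
  have hb : rotation a ⁻¹' ball (0 : ℂ) 1 = ball 0 1 := by
    ext ζ
    simp only [mem_preimage, mem_ball_zero_iff, LinearIsometryEquiv.norm_map]
  rwa [hb] at h

theorem exists_circle_mul (w : ℂ) : ∃ a : Circle, w = ‖w‖ * a := by
  refine ⟨Circle.exp w.arg, ?_⟩
  rw [Circle.coe_exp, Complex.norm_mul_exp_arg_mul_I]

namespace IsTailDoubling

variable {μ : Measure ℝ}

theorem continuousOn_kernelSeries (h : IsTailDoubling μ) {x : ℂ} (hx : ‖x‖ < 1) :
    ContinuousOn (fun ζ => kernelSeries μ (x * ζ)) (ball 0 1) ∧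
      ∃ C : ℝ, ∀ ζ ∈ ball (0 : ℂ) 1, ‖kernelSeries μ (x * ζ)‖ ≤ C := by
  have hs := h.summable_kernelCoeff (norm_nonneg x) hx
  have hb : ∀ n : ℕ, ∀ ζ ∈ ball (0 : ℂ) 1,
      ‖(kernelCoeff μ n : ℂ) * (x * ζ) ^ n‖ ≤ kernelCoeff μ n * ‖x‖ ^ n := by
    intro n ζ hζ
    have hc := h.kernelCoeff_pos n
    rw [norm_mul, norm_pow, norm_mul, Complex.norm_real, Real.norm_of_nonneg hc.le]
    gcongr
    exact mul_le_of_le_one_right (norm_nonneg _) (mem_ball_zero_iff.1 hζ).le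
  exact ⟨continuousOn_tsum (fun n => by fun_prop) hs hb, _,
    fun ζ hζ => tsum_of_norm_bounded hs.hasSum fun n => hb n ζ hζ⟩

/-- Polar coordinates for the integral of the regularized kernel. -/
theorem lintegral_regularized_kernel (h : IsTailDoubling μ) {ν : ℝ → ℝ} (hν : IsRadialWeight ν)
    {p : ℝ} (hp : 0 ≤ p) (N : ℕ) {z : ℂ} (hz : z ∈ ball (0 : ℂ) 1) :
    ∫⁻ ζ, ENNReal.ofReal (‖(1 - conj z * ζ) ^ N * kernelSeries μ (conj z * ζ)‖ ^ p * ν ‖ζ‖)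
        ∂diskArea =
      ENNReal.ofReal Real.pi⁻¹ *
        ∫⁻ r, ENNReal.ofReal r * kernelMean μ p N (‖z‖ * r) ∂weightMeasure ν := by
  obtain ⟨a, ha⟩ := exists_circle_mul (conj z)
  rw [Complex.norm_conj] at ha
  set F : ℂ → ℝ := fun ζ => ‖(1 - ‖z‖ * ζ) ^ N * kernelSeries μ (‖z‖ * ζ)‖ ^ p with hF
  have hz1 : ‖(‖z‖ : ℂ)‖ < 1 := by
    rw [Complex.norm_real, norm_norm]; exact mem_ball_zero_iff.1 hz
  have hFc : ContinuousOn F (ball 0 1) := by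
    have := (h.continuousOn_kernelSeries hz1).1
    refine ContinuousOn.rpow_const (ContinuousOn.norm ?_) fun _ _ => Or.inr hp
    exact ContinuousOn.mul (by fun_prop) this
  have h1 := (measurePreserving_rotation_diskArea a).lintegral_comp_emb
    (rotation a).toHomeomorph.measurableEmbedding fun ζ => ENNReal.ofReal (F ζ * ν ‖ζ‖)
  rw [lintegral_diskArea_polar hν hFc fun ζ => by positivity] at h1
  have h2 : ∀ ζ, ENNReal.ofReal (‖(1 - conj z * ζ) ^ N * kernelSeries μ (conj z * ζ)‖ ^ p * ν ‖ζ‖) =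
      ENNReal.ofReal (F (rotation a ζ) * ν ‖rotation a ζ‖) := by
    intro ζ
    rw [LinearIsometryEquiv.norm_map, rotation_apply, hF]
    simp only
    rw [← mul_assoc, ← ha]
  simp_rw [h2]
  rw [h1]
  have h3 : ∀ r θ : ℝ, circleMap 0 (‖z‖ * r) θ = ‖z‖ * circleMap 0 r θ := by
    intro r θ
    rw [circleMap_zero, circleMap_zero]
    push_cast
    ring
  unfold kernelMean
  simp_rw [h3]
  rfl

/-- The tail of `μ` decreases, so on `(0,x]` the density is at most `τ(x)^(-p)`. The integral is
therefore finite, and the Bochner and Lebesgue versions agree. -/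
theorem ofReal_integral_kernelDensity (h : IsTailDoubling μ) {ν : Measure ℝ} [IsFiniteMeasure ν]
    {p : ℝ} (hp : 0 ≤ p) {N : ℕ} (hN : 1 ≤ N) {x : ℝ} (hx : x ∈ Ico (0 : ℝ) 1) :
    ENNReal.ofReal (∫ t in (0 : ℝ)..x, ν.real (Ioi t) * kernelDensity μ p N t) =
      ∫⁻ t in Ioc 0 x, ENNReal.ofReal (kernelDensity μ p N t) * ν (Ioi t) := by
  have := h.isFinite
  have hmem : ∀ t ∈ Ioc 0 x, t ∈ Ico (0 : ℝ) 1 := fun t ht => ⟨ht.1.le, ht.2.trans_lt hx.2⟩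
  have hτx := h.tail_pos x hx
  have hint : IntegrableOn (fun t => ν.real (Ioi t) * kernelDensity μ p N t) (Ioc 0 x) := by
    refine Measure.integrableOn_of_bounded (M := ν.real univ * (1 / μ.real (Ioi x)) ^ p)
      (by simp) ?_ ((ae_restrict_iff' measurableSet_Ioc).2
        (Filter.Eventually.of_forall fun t ht => ?_))
    · exact ((tail_antitone ν).measurable.mul
        (measurable_kernelDensity μ p N)).aestronglyMeasurable
    · have hd := h.kernelDensity_nonneg p N (hmem t ht)
      have ht1 : 0 ≤ 1 - t := by linarith [(hmem t ht).2]
      have hle : kernelDensity μ p N t ≤ (1 / μ.real (Ioi x)) ^ p := by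
        rw [h.kernelDensity_eq p hN (hmem t ht)]
        refine Real.rpow_le_rpow (by positivity) ?_ hp
        exact div_le_div₀ zero_le_one (pow_le_one₀ ht1 (by linarith [ht.1])) hτx
          (tail_antitone μ ht.2)
      rw [Real.norm_of_nonneg (mul_nonneg measureReal_nonneg hd)]
      exact mul_le_mul (measureReal_mono (subset_univ _)) hle hd measureReal_nonneg
  rw [intervalIntegral.integral_of_le hx.1, ofReal_integral_eq_lintegral_ofReal hint]
  · refine setLIntegral_congr_fun measurableSet_Ioc fun t ht => ?_
    rw [mul_comm, ENNReal.ofReal_mul (h.kernelDensity_nonneg p N (hmem t ht)), ofReal_measureReal]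
  · exact (ae_restrict_iff' measurableSet_Ioc).2 (Filter.Eventually.of_forall fun t ht =>
      mul_nonneg measureReal_nonneg (h.kernelDensity_nonneg p N (hmem t ht)))

end IsTailDoubling

/-! ### The theorem -/

theorem mainTheorem6 (p : ℝ) (hp : 2 ≤ p) (N : ℕ) (hN : 1 ≤ N) (ω ν : ℝ → ℝ)
    (hω : MemDHat ω) (hν : IsRadialWeight ν) :
    (∀ z ∈ ball (0 : ℂ) 1,
      Integrable (fun ζ => ‖(1 - conj z * ζ) ^ N * bergmanKernel ω z ζ‖ ^ p * ν ‖ζ‖) diskArea) ∧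
    (∃ C > (0 : ℝ), ∀ z ∈ ball (0 : ℂ) 1,
      ∫ ζ, ‖(1 - conj z * ζ) ^ N * bergmanKernel ω z ζ‖ ^ p * ν ‖ζ‖ ∂diskArea ≤
        C * ((∫ t in (0 : ℝ)..‖z‖,
          weightTail ν t / (weightTail ω t ^ p * (1 - t) ^ (p * (1 - (N : ℝ))))) + 1)) ∧
    (MemD ν → ∃ c > (0 : ℝ), ∀ z ∈ ball (0 : ℂ) 1,
      c * ((∫ t in (0 : ℝ)..‖z‖,
          weightTail ν t / (weightTail ω t ^ p * (1 - t) ^ (p * (1 - (N : ℝ))))) + 1) ≤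
        ∫ ζ, ‖(1 - conj z * ζ) ^ N * bergmanKernel ω z ζ‖ ^ p * ν ‖ζ‖ ∂diskArea) := by
  have hp0 : 0 ≤ p := by linarith
  have h := hω.isTailDoubling
  set μ := weightMeasure ω with hμ
  have := hν.isFiniteMeasure
  have hpi := Real.pi_pos
  have hker : ∀ z ∈ ball (0 : ℂ) 1, ∀ ζ ∈ ball (0 : ℂ) 1,
      ‖(1 - conj z * ζ) ^ N * bergmanKernel ω z ζ‖ ^ p * ν ‖ζ‖ =
        ‖(1 - conj z * ζ) ^ N * kernelSeries μ (conj z * ζ)‖ ^ p * ν ‖ζ‖ := by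
    intro z hz ζ hζ
    rw [bergmanKernel_eq_kernelSeries hω.1 hz hζ]
  have hint : ∀ z ∈ ball (0 : ℂ) 1, Integrable
      (fun ζ => ‖(1 - conj z * ζ) ^ N * bergmanKernel ω z ζ‖ ^ p * ν ‖ζ‖) diskArea := by
    intro z hz
    have hz1 : ‖conj z‖ < 1 := by rw [Complex.norm_conj]; exact mem_ball_zero_iff.1 hz
    obtain ⟨hcont, C, hC⟩ := h.continuousOn_kernelSeries hz1
    refine Integrable.congr ?_ (ae_diskArea fun ζ hζ => (hker z hz ζ hζ).symm)
    -- For fixed `z` the argument `conj z * ζ` stays in the disc of radius `|z| < 1`, so the kernel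
    -- is bounded and integrability reduces to that of `ν`.
    refine hν.integrable_diskArea.bdd_mul (c := (2 ^ N * C) ^ p) ?_ (ae_diskArea fun ζ hζ => ?_)
    · unfold diskArea
      refine (ContinuousOn.aestronglyMeasurable ?_ measurableSet_ball).smul_measure _
      refine ContinuousOn.rpow_const (ContinuousOn.norm ?_) fun _ _ => Or.inr hp0
      exact ContinuousOn.mul (by fun_prop) hcont
    · rw [Real.norm_of_nonneg (by positivity)]
      refine Real.rpow_le_rpow (norm_nonneg _) ?_ hp0
      rw [norm_mul, norm_pow]
      have h1 : ‖1 - conj z * ζ‖ ≤ 2 := by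
        refine (norm_sub_le _ _).trans ?_
        rw [norm_one, norm_mul]
        have := mul_le_one₀ hz1.le (norm_nonneg ζ) (mem_ball_zero_iff.1 hζ).le
        linarith
      have h2 := hC ζ hζ
      gcongr
  have hLHS : ∀ z ∈ ball (0 : ℂ) 1, ENNReal.ofReal
      (∫ ζ, ‖(1 - conj z * ζ) ^ N * bergmanKernel ω z ζ‖ ^ p * ν ‖ζ‖ ∂diskArea) =
        ENNReal.ofReal Real.pi⁻¹ *
          ∫⁻ r, ENNReal.ofReal r * kernelMean μ p N (‖z‖ * r) ∂weightMeasure ν := by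
    intro z hz
    rw [ofReal_integral_eq_lintegral_ofReal (hint z hz) (ae_diskArea fun ζ hζ =>
      mul_nonneg (by positivity) (hν.nonneg_norm hζ)), ← h.lintegral_regularized_kernel hν hp0 N hz]
    exact lintegral_congr_ae (ae_diskArea fun ζ hζ => congrArg ENNReal.ofReal (hker z hz ζ hζ))
  have hnorm : ∀ z ∈ ball (0 : ℂ) 1, ‖z‖ ∈ Ico (0 : ℝ) 1 :=
    fun z hz => ⟨norm_nonneg z, mem_ball_zero_iff.1 hz⟩
  have hJeq : ∀ z ∈ ball (0 : ℂ) 1, ∫ t in (0 : ℝ)..‖z‖,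
      weightTail ν t / (weightTail ω t ^ p * (1 - t) ^ (p * (1 - (N : ℝ)))) =
        ∫ t in (0 : ℝ)..‖z‖, (weightMeasure ν).real (Ioi t) * kernelDensity μ p N t := by
    intro z hz
    refine intervalIntegral.integral_congr fun t ht => ?_
    rw [uIcc_of_le (norm_nonneg z)] at ht
    have ht' : t ∈ Ico (0 : ℝ) 1 := ⟨ht.1, ht.2.trans_lt (hnorm z hz).2⟩
    rw [hν.measureReal_Ioi ht', kernelDensity, hμ, hω.1.measureReal_Ioi ht', div_eq_mul_inv]
  have hJ0 : ∀ z ∈ ball (0 : ℂ) 1, 0 ≤ ∫ t in (0 : ℝ)..‖z‖,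
      (weightMeasure ν).real (Ioi t) * kernelDensity μ p N t := by
    intro z hz
    refine intervalIntegral.integral_nonneg (norm_nonneg z) fun t ht => ?_
    exact mul_nonneg measureReal_nonneg
      (h.kernelDensity_nonneg p N ⟨ht.1, ht.2.trans_lt (hnorm z hz).2⟩)
  have hRHS : ∀ z ∈ ball (0 : ℂ) 1,
      (∫⁻ t in Ioc 0 ‖z‖, ENNReal.ofReal (kernelDensity μ p N t) * weightMeasure ν (Ioi t)) + 1 =
        ENNReal.ofReal ((∫ t in (0 : ℝ)..‖z‖,
          (weightMeasure ν).real (Ioi t) * kernelDensity μ p N t) + 1) := by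
    intro z hz
    rw [ENNReal.ofReal_add (hJ0 z hz) zero_le_one, ENNReal.ofReal_one,
      h.ofReal_integral_kernelDensity hp0 hN (hnorm z hz)]
  refine ⟨hint, ?_, fun hνD => ?_⟩
  · obtain ⟨C, hC, hle⟩ := h.lintegral_kernelMean_le hν.ae_mem hp0 hN
    refine ⟨Real.pi⁻¹ * C, by positivity, fun z hz => ?_⟩
    have h1 := hle _ (hnorm z hz)
    have h2 := hJ0 z hz
    rw [hRHS z hz] at h1
    rw [hJeq z hz, ← ENNReal.ofReal_le_ofReal_iff (by positivity), hLHS z hz, mul_assoc,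
      ENNReal.ofReal_mul (by positivity), ENNReal.ofReal_mul hC.le]
    gcongr
  · have hshell := hνD.1.isTailDoubling.tail_le_lintegral_shell (by
      obtain ⟨C, hC, K, hK, hmom⟩ := hνD.2.2
      refine ⟨C, hC, K, hK, fun x hx => ?_⟩
      rw [hν.integral_rpow, hν.integral_rpow]
      exact hmom x hx)
    obtain ⟨C, hC, hle⟩ :=
      h.le_lintegral_kernelMean hν.ae_mem hν.weightMeasure_ne_zero hshell hp0 hN
    -- The factor `π` comes from the normalization of `dA`: the integral over circles and radii is
    -- `π` times the area integral `I`.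
    refine ⟨(C * Real.pi)⁻¹, by positivity, fun z hz => ?_⟩
    have h1 := hle _ (hnorm z hz)
    have h2 := hLHS z hz
    set I := ∫ ζ, ‖(1 - conj z * ζ) ^ N * bergmanKernel ω z ζ‖ ^ p * ν ‖ζ‖ ∂diskArea with hI
    set T := ∫⁻ r, ENNReal.ofReal r * kernelMean μ p N (‖z‖ * r) ∂weightMeasure ν with hT
    have hI0 : 0 ≤ I := integral_nonneg_of_ae (ae_diskArea fun ζ hζ =>
      mul_nonneg (by positivity) (hν.nonneg_norm hζ))
    have hT' : T = ENNReal.ofReal Real.pi * ENNReal.ofReal I := by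
      rw [h2, ← mul_assoc, ← ENNReal.ofReal_mul hpi.le, mul_inv_cancel₀ hpi.ne',
        ENNReal.ofReal_one, one_mul]
    rw [hRHS z hz, hT', ← ENNReal.ofReal_mul hpi.le, ← ENNReal.ofReal_mul hC.le,
      ENNReal.ofReal_le_ofReal_iff (by positivity)] at h1
    rw [hJeq z hz, inv_mul_le_iff₀ (by positivity)]
    linarith
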